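/- Let $\mathcal A$ be a finite alphabet, $\Omega=\mathcal A^{\mathbb N}$ the one-sided shift space with the $\sigma$-field generated by the cylinders $[w]=\{y\in\Omega: y_1^{n}=w\}$, $w\in\mathcal A^n$, where $y_1^n=(y_1,\dots,y_n)$, and let $T$, $(Tx)_k=x_{k+1}$, be the left shift. Let $\mathbb P$ be a $T$-invariant probability measure on $\Omega$. Write $H(\mathbb P_n)=-\sum_{a\in\mathcal A^n}\mathbb P([a])\log\mathbb P([a])$ (with $0\log 0=0$) and let $h(\mathbb P)=\lim_{n\to\infty}\frac1n H(\mathbb P_n)$ be the entropy rate of $\mathbb P$; this limit exists. Put $h_{\mathbb P}(x)=\limsup_{N\to\infty}-\frac1N\log\mathbb P([x_1^N])$. Then $h_{\mathbb P}$ is the entropy rate function of the Shannon--McMillan--Breiman theorem: it is $\mathbb P$-integrable, $h_{\mathbb P}\circ T=h_{\mathbb P}$ $\mathbb P$-a.s., and $-\frac1N\log\mathbb P([x_1^N])\to h_{\mathbb P}(x)$ as $N\to\infty$, $\mathbb P$-a.s. and in $L^1(\mathbb P)$. For each $N\ge1$ and each $x\in\Omega$, let $x_1^N=w_1^{(N)}(x)\,w_2^{(N)}(x)\cdots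 w_{c_N(x)}^{(N)}(x)$ be a decomposition of $x_1^N$ into consecutive nonempty blocks, where the number of blocks $c_N(x)$ and the blocks themselves are measurable functions of $x\in\Omega$ but are otherwise arbitrary (a parsing). Suppose that $c_N(x)/N\to0$ as $N\to\infty$ for $\mathbb P$-a.e. $x$. Then $$\lim_{N\to\infty}\frac1N\sum_{i=1}^{c_N(x)}-\log\mathbb P\bigl([w_i^{(N)}(x)]\bigr)=h_{\mathbb P}(x),\qquad \mathbb P\text{-a.s. and in }L^1(\mathbb P).$$ Moreover, $\mathbb E_{\mathbb P}(h_{\mathbb P})=h(\mathbb P)$. -/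

import Mathlib

open MeasureTheory Filter Topology

noncomputable section

namespace ShiftSpace

variable {A : Type*}

/-- The left shift on one-sided sequences; the coordinate `x_k`, `k ≥ 1`, is `x (k - 1)` here. -/
def shift (x : ℕ → A) : ℕ → A := fun k => x (k + 1)

/-- The word formed by the first `n` letters of `x`. -/
def initialWord (x : ℕ → A) (n : ℕ) : List A := List.ofFn fun i : Fin n => x i

/-- The cylinder `[w]` of a finite word `w`: all sequences that begin with `w`. -/
def cylinder (w : List A) : Set (ℕ → A) := {y | initialWord y w.length = w}

/-- A (data-dependent) parsing: for all `N` and `x`, the list of blocks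
`w_1^{(N)}(x), …, w_{c_N(x)}^{(N)}(x)`. The blocks are nonempty words whose concatenation is the
initial word of length `N` of `x`, and they depend measurably on `x` (the set of lists of words is
countable and carries the discrete σ-algebra). For `N = 0` the list is forced to be empty. -/
structure Parsing (A : Type*) [MeasurableSpace A] where
  blocks : ℕ → (ℕ → A) → List (List A)
  measurableSet_blocks_eq : ∀ (N : ℕ) (l : List (List A)), MeasurableSet {x | blocks N x = l}
  blocks_ne_nil : ∀ (N : ℕ) (x : ℕ → A), ∀ w ∈ blocks N x, w ≠ []
  flatten_blocks : ∀ (N : ℕ) (x : ℕ → A), (blocks N x).flatten = initialWord x N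

variable [MeasurableSpace A]

/-- The number of blocks `c_N(x)`. -/
def Parsing.count (W : Parsing A) (N : ℕ) (x : ℕ → A) : ℕ := (W.blocks N x).length

/-- The quantity `-log P([w])` for a word `w`. -/
def negLogProb (P : Measure (ℕ → A)) (w : List A) : ℝ := -Real.log (P.real (cylinder w))

/-- The quantity `(1/N) ∑_{i ≤ c_N(x)} -log P([w_i^{(N)}(x)])`. -/
def Parsing.average (W : Parsing A) (P : Measure (ℕ → A)) (N : ℕ) (x : ℕ → A) : ℝ :=
  (1 / (N : ℝ)) * ((W.blocks N x).map (negLogProb P)).sum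

/-- The quantity `-(1/N) log P([x_1^N])`. -/
def infoRate (P : Measure (ℕ → A)) (N : ℕ) (x : ℕ → A) : ℝ :=
  (1 / (N : ℝ)) * negLogProb P (initialWord x N)

/-- Convergence of `f N` to `g` in `L¹(P)`, for functions in `L¹(P)`. -/
def TendstoInL1 (P : Measure (ℕ → A)) (f : ℕ → (ℕ → A) → ℝ) (g : (ℕ → A) → ℝ) : Prop :=
  (∀ N, Integrable (f N) P) ∧ Integrable g P ∧
    Tendsto (fun N => eLpNorm (f N - g) 1 P) atTop (𝓝 0)

/-- The entropy rate function of `P`, as the pointwise upper limit of `-(1/N) log P([x_1^N])`. -/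
def entropyRateFunction (P : Measure (ℕ → A)) (x : ℕ → A) : ℝ :=
  limsup (fun N => infoRate P N x) atTop

/-- The properties that determine the entropy rate function (up to `P`-null sets): it is
integrable, shift-invariant, and the limit of `-(1/N) log P([x_1^N])`, almost surely and
in `L¹(P)`. -/
structure IsEntropyRateFunction (P : Measure (ℕ → A)) (h : (ℕ → A) → ℝ) : Prop where
  integrable : Integrable h P
  shift_invariant : ∀ᵐ x ∂P, h (shift x) = h x
  tendsto_ae : ∀ᵐ x ∂P, Tendsto (fun N => infoRate P N x) atTop (𝓝 (h x))
  tendsto_L1 : TendstoInL1 P (infoRate P) h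

/-- The Shannon entropy `H(P_n)` of the `n`-th marginal of `P`. -/
def blockEntropy [Fintype A] (P : Measure (ℕ → A)) (n : ℕ) : ℝ :=
  -∑ a : Fin n → A,
    P.real (cylinder (List.ofFn a)) * Real.log (P.real (cylinder (List.ofFn a)))

/-- The entropy rate `h(P) = lim (1/n) H(P_n)`. -/
def entropyRate [Fintype A] (P : Measure (ℕ → A)) : ℝ :=
  limUnder atTop fun n : ℕ => (1 / (n : ℝ)) * blockEntropy P n

end ShiftSpace

end

/-! Information is nearly additive over few blocks, and every comparison comes from one principle.
If weights `Q` on words of length `n` have total mass growing more slowly than `exp (θ n)`, then the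
sum of `exp (-θ n) * Q / P` over `n` is integrable, so `-log P ≤ -log Q + θ n + log Z` along almost
every sequence, with `Z` integrable (`exists_integrable_negLogProb_le`).

Lower bound: let `Q` sum `∏ δ P([w_i])` over all parsings of a word. Its mass is at most `(1 + δ) ^
n`, so every parsing costs at least the information of `x_1^N`, up to `log (1/δ)` per block and
about `δ` per letter (`ae_negLogProb_le_sum_blocks`).

Upper bound: let `Q` be the Markov approximation of order `k`. Then a block costs at most the
Birkhoff sum of `condInfo P k` over it, plus a constant and `log Z` at its starting point. As `log Z
≤ K + exp (-K) * Z`, the block starts together cost `K` per block and a small multiple of the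
Birkhoff sum of `Z`. The ergodic theorem turns this into a conditional expectation of `condInfo P k`
on the invariant sets (`ae_sum_blocks_le_condInfo`), and these have infimum `h_P` over `k`
(`ae_exists_condExp_lt`).

Almost sure convergence of `infoRate` is itself a consequence of the lower bound, applied to a
greedy parsing into blocks whose rate is close to the lower limit (`ae_eventually_infoRate_le`).
Convergence in `L¹` follows by uniform integrability. -/

set_option linter.unusedSectionVars false

/-! ### The maximal ergodic theorem and the upper half of Birkhoff's theorem. -/

section ErgodicTheorem

variable {Ω : Type*} {T : Ω → Ω} {g : Ω → ℝ}

/-- The maximum of the Birkhoff sums `S_0 g = 0, S_1 g, …, S_n g`. -/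
noncomputable def maximalBirkhoffSum (T : Ω → Ω) (g : Ω → ℝ) : ℕ → Ω → ℝ
  | 0, _ => 0
  | n + 1, x => max 0 (g x + maximalBirkhoffSum T g n (T x))

theorem maximalBirkhoffSum_nonneg (n : ℕ) (x : Ω) : 0 ≤ maximalBirkhoffSum T g n x := by
  cases n <;> simp [maximalBirkhoffSum]

theorem maximalBirkhoffSum_le_succ (n : ℕ) (x : Ω) :
    maximalBirkhoffSum T g n x ≤ maximalBirkhoffSum T g (n + 1) x := by
  induction n generalizing x with
  | zero => simp [maximalBirkhoffSum]
  | succ n ih => exact max_le_max le_rfl (by linarith [ih (T x)])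

theorem birkhoffSum_le_maximalBirkhoffSum (n : ℕ) (x : Ω) :
    birkhoffSum T g n x ≤ maximalBirkhoffSum T g n x := by
  induction n generalizing x with
  | zero => simp [maximalBirkhoffSum]
  | succ n ih =>
    rw [birkhoffSum_succ']
    exact le_max_of_le_right (by linarith [ih (T x)])

variable [MeasurableSpace Ω] {μ : Measure Ω}

theorem MeasureTheory.MeasurePreserving.integrable_fun_comp
    (hT : MeasurePreserving T μ μ) (hg : Integrable g μ) : Integrable (fun x => g (T x)) μ :=
  hT.integrable_comp_of_integrable hg

theorem MeasureTheory.MeasurePreserving.integrable_maximalBirkhoffSum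
    (hT : MeasurePreserving T μ μ) (hg : Integrable g μ) (n : ℕ) :
    Integrable (maximalBirkhoffSum T g n) μ := by
  induction n with
  | zero => exact integrable_zero _ _ _
  | succ n ih => exact (integrable_zero _ _ _).sup (hg.add (hT.integrable_fun_comp ih))

theorem MeasureTheory.MeasurePreserving.integrable_birkhoffSum
    (hT : MeasurePreserving T μ μ) (hg : Integrable g μ) (n : ℕ) :
    Integrable (birkhoffSum T g n) μ := by
  induction n with
  | zero => simp
  | succ n ih =>
    have : birkhoffSum T g (n + 1) = fun x => g x + birkhoffSum T g n (T x) :=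
      funext fun x => birkhoffSum_succ' T g n x
    rw [this]
    exact hg.add (hT.integrable_fun_comp ih)

theorem MeasureTheory.MeasurePreserving.integral_comp_of_integrable
    (hT : MeasurePreserving T μ μ) (hg : Integrable g μ) : ∫ x, g (T x) ∂μ = ∫ x, g x ∂μ := by
  have := integral_map (f := g) hT.aemeasurable (by rw [hT.map_eq]; exact hg.aestronglyMeasurable)
  rw [← this, hT.map_eq]

theorem MeasureTheory.MeasurePreserving.integral_birkhoffSum
    (hT : MeasurePreserving T μ μ) (hg : Integrable g μ) (n : ℕ) :
    ∫ x, birkhoffSum T g n x ∂μ = n * ∫ x, g x ∂μ := by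
  induction n with
  | zero => simp
  | succ n ih =>
    simp_rw [birkhoffSum_succ']
    have hi := hT.integrable_birkhoffSum hg n
    rw [integral_add hg (hT.integrable_fun_comp hi), hT.integral_comp_of_integrable hi, ih]
    push_cast; ring

/-- A form of the maximal ergodic theorem. -/
theorem MeasureTheory.MeasurePreserving.integral_nonneg_of_birkhoffSum_unbounded
    (hT : MeasurePreserving T μ μ) (hg : Integrable g μ)
    (hub : ∀ᵐ x ∂μ, ∀ K : ℝ, ∃ n, K < birkhoffSum T g n (T x)) : 0 ≤ ∫ x, g x ∂μ := by
  have hM := hT.integrable_maximalBirkhoffSum hg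
  -- The integrand is eventually `g x`, since the maximal sums at `T x` are unbounded. It also
  -- equals `M_{n+1} - M_n ∘ T`, whose integral is that of `M_{n+1} - M_n ≥ 0`.
  have hlim : Tendsto (fun n => ∫ x, max (-maximalBirkhoffSum T g n (T x)) (g x) ∂μ) atTop
      (𝓝 (∫ x, g x ∂μ)) := by
    refine tendsto_integral_of_dominated_convergence (fun x => |g x|) (fun n => ?_) hg.abs
      (fun n => ?_) ?_
    · exact ((hT.integrable_fun_comp (hM n)).neg.sup hg).aestronglyMeasurable
    · refine ae_of_all _ fun x => ?_
      have := maximalBirkhoffSum_nonneg (T := T) (g := g) n (T x)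
      rw [Real.norm_eq_abs]
      refine abs_le.2 ⟨le_max_of_le_right (neg_abs_le _), max_le ?_ (le_abs_self _)⟩
      linarith [abs_nonneg (g x)]
    · filter_upwards [hub] with x hx
      obtain ⟨n, hn⟩ := hx (-g x)
      refine tendsto_const_nhds.congr' ?_
      filter_upwards [eventually_ge_atTop n] with k hk
      have h1 : maximalBirkhoffSum T g n (T x) ≤ maximalBirkhoffSum T g k (T x) :=
        monotone_nat_of_le_succ (f := fun k => maximalBirkhoffSum T g k (T x))
          (fun k => maximalBirkhoffSum_le_succ k (T x)) hk
      have h2 := birkhoffSum_le_maximalBirkhoffSum (T := T) (g := g) n (T x)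
      exact (max_eq_right (by linarith)).symm
  refine ge_of_tendsto' hlim fun n => ?_
  have heq : ∀ x, max (-maximalBirkhoffSum T g n (T x)) (g x)
      = maximalBirkhoffSum T g (n + 1) x - maximalBirkhoffSum T g n (T x) := fun x => by
    rw [maximalBirkhoffSum, ← max_sub_sub_right]; simp
  simp_rw [heq]
  rw [integral_sub (hM _) (hT.integrable_fun_comp (hM n)),
    hT.integral_comp_of_integrable (hM n), sub_nonneg]
  exact integral_mono (hM n) (hM (n + 1)) (maximalBirkhoffSum_le_succ n)

/-- The upper half of Birkhoff's pointwise ergodic theorem. -/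
theorem MeasureTheory.MeasurePreserving.ae_eventually_birkhoffSum_le [IsProbabilityMeasure μ]
    (hT : MeasurePreserving T μ μ) (hg : Integrable g μ) :
    ∀ᵐ x ∂μ, ∀ ε > 0, ∀ᶠ N : ℕ in atTop,
      birkhoffSum T g N x ≤ ((μ[g|MeasurableSpace.invariants T]) x + ε) * N := by
  set φ := μ[g|MeasurableSpace.invariants T] with hφ
  have hle : MeasurableSpace.invariants T ≤ ‹MeasurableSpace Ω› := MeasurableSpace.invariants_le T
  have hφT : φ ∘ T = φ :=
    MeasurableSpace.comp_eq_of_measurable_invariants stronglyMeasurable_condExp.measurable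
  -- reduce to a measurable representative, so that the exceptional set is measurable
  obtain ⟨g', hg'm, hgg'⟩ := hg.aestronglyMeasurable
  have hg' : Integrable g' μ := hg.congr hgg'
  have hsum : ∀ᵐ x ∂μ, ∀ n, birkhoffSum T g n x = birkhoffSum T g' n x := by
    have : ∀ᵐ x ∂μ, ∀ k, g (T^[k] x) = g' (T^[k] x) := ae_all_iff.2 fun k =>
      (hT.iterate k).quasiMeasurePreserving.ae hgg'
    filter_upwards [this] with x hx n
    exact Finset.sum_congr rfl fun k _ => hx k
  -- The set `E` where the sums of `u = g' - φ - ε` are unbounded above is invariant. The maximal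
  -- theorem on `E` gives `0 ≤ ∫_E u`, while conditioning gives `∫_E u = -ε μ(E)`; so `E` is null.
  have key : ∀ ε > 0, ∀ᵐ x ∂μ, ∃ K : ℝ, ∀ n : ℕ, birkhoffSum T g' n x ≤ n * (φ x + ε) + K := by
    intro ε hε
    set u : Ω → ℝ := fun x => g' x - φ x - ε with hu
    have hui : Integrable u μ := (hg'.sub integrable_condExp).sub (integrable_const ε)
    have hum : Measurable u :=
      (hg'm.measurable.sub (stronglyMeasurable_condExp.measurable.mono hle le_rfl)).sub_const ε
    have hS : ∀ n x, birkhoffSum T u n x = birkhoffSum T g' n x - n * (φ x + ε) := by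
      intro n
      induction n with
      | zero => simp
      | succ n ih =>
        intro x
        rw [birkhoffSum_succ', birkhoffSum_succ', ih, show φ (T x) = φ x from congrFun hφT x]
        simp only [hu]; push_cast; ring
    have hSm : ∀ n, Measurable (birkhoffSum T u n) := fun n =>
      Finset.measurable_sum _ fun k _ => hum.comp (hT.measurable.iterate k)
    set E : Set Ω := {x | ∀ K : ℕ, ∃ n, (K : ℝ) < birkhoffSum T u n x} with hE
    have hEm : MeasurableSet E := by
      have : E = ⋂ K : ℕ, ⋃ n, {x | (K : ℝ) < birkhoffSum T u n x} := by ext; simp [hE]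
      rw [this]
      exact .iInter fun K => .iUnion fun n => measurableSet_lt measurable_const (hSm n)
    have hEr : ∀ x, x ∈ E ↔ ∀ K : ℝ, ∃ n, K < birkhoffSum T u n x := fun x =>
      ⟨fun h K => by
        obtain ⟨k, hk⟩ := exists_nat_ge K
        obtain ⟨n, hn⟩ := h k
        exact ⟨n, hk.trans_lt hn⟩, fun h K => h K⟩
    have hET : T ⁻¹' E = E := by
      ext x
      rw [Set.mem_preimage, hEr, hEr]
      constructor
      · intro h K
        obtain ⟨n, hn⟩ := h (K - u x)
        exact ⟨n + 1, by rw [birkhoffSum_succ']; linarith⟩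
      · intro h K
        -- The maximum with `0` excludes the empty sum `n = 0`.
        obtain ⟨n, hn⟩ := h (max 0 (K + u x))
        cases n with
        | zero => simp at hn
        | succ n =>
          rw [birkhoffSum_succ'] at hn
          exact ⟨n, by linarith [le_max_right 0 (K + u x)]⟩
    have hTE : MeasurePreserving T (μ.restrict E) (μ.restrict E) := by
      have := hT.restrict_preimage hEm
      rwa [hET] at this
    have h0 : 0 ≤ ∫ x in E, u x ∂μ := by
      refine hTE.integral_nonneg_of_birkhoffSum_unbounded hui.integrableOn ?_
      filter_upwards [ae_restrict_mem hEm] with x hx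
      exact (hEr _).1 (by rwa [← Set.mem_preimage, hET])
    have h1 : ∫ x in E, u x ∂μ = -(ε * μ.real E) := by
      simp only [hu]
      have hd : Integrable (fun x => g' x - φ x) μ := hg'.sub integrable_condExp
      rw [integral_sub hd.integrableOn (integrable_const ε).integrableOn,
        integral_sub hg'.integrableOn integrable_condExp.integrableOn,
        setIntegral_condExp hle hg (MeasurableSpace.measurableSet_invariants.2 ⟨hEm, hET⟩),
        setIntegral_congr_ae hEm (hgg'.mono fun x hx _ => hx)]
      simp [mul_comm]
    have hE0 : μ.real E = 0 := by
      have := measureReal_nonneg (μ := μ) (s := E)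
      nlinarith
    have hE0' : μ E = 0 := (measureReal_eq_zero_iff).1 hE0
    filter_upwards [measure_eq_zero_iff_ae_notMem.1 hE0'] with x hx
    simp only [hE, Set.mem_ofPred_eq, not_forall, not_exists, not_lt] at hx
    obtain ⟨K, hK⟩ := hx
    exact ⟨K, fun n => by linarith [hK n, hS n x]⟩
  have key' : ∀ᵐ x ∂μ, ∀ m : ℕ, ∃ K : ℝ, ∀ n : ℕ,
      birkhoffSum T g' n x ≤ n * (φ x + 1 / ((m : ℝ) + 1)) + K :=
    ae_all_iff.2 fun m => key _ (by positivity)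
  filter_upwards [hsum, key'] with x hx hk ε hε
  obtain ⟨m, hm⟩ := exists_nat_one_div_lt hε
  obtain ⟨K, hK⟩ := hk m
  have : ∀ᶠ N : ℕ in atTop, K / (ε - 1 / ((m : ℝ) + 1)) ≤ N :=
    tendsto_natCast_atTop_atTop.eventually_ge_atTop _
  filter_upwards [this] with N hN
  rw [div_le_iff₀ (by linarith)] at hN
  rw [hx]
  nlinarith [hK N]

/-- A sequence of nonnegative functions whose integrals come arbitrarily close to `0` has
infimum `0` almost everywhere. -/
theorem ae_exists_lt_of_exists_integral_lt [IsFiniteMeasure μ] {f : ℕ → Ω → ℝ}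
    (hf : ∀ k, Integrable (f k) μ) (h0 : ∀ k, 0 ≤ᵐ[μ] f k)
    (hinf : ∀ ε > 0, ∃ k, ∫ x, f k x ∂μ < ε) :
    ∀ᵐ x ∂μ, ∀ ε > 0, ∃ k, f k x < ε := by
  have key : ∀ ε > 0, ∀ᵐ x ∂μ, ∃ k, f k x < ε := by
    intro ε hε
    have hz : μ.real {x | ∀ k, ε ≤ f k x} = 0 := by
      refine le_antisymm (le_of_forall_pos_lt_add fun η hη => ?_) measureReal_nonneg
      obtain ⟨k, hk⟩ := hinf (ε * η) (by positivity)
      have h1 := mul_meas_ge_le_integral_of_nonneg (h0 k) (hf k) ε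
      have h2 : μ.real {x | ∀ k, ε ≤ f k x} ≤ μ.real {x | ε ≤ f k x} :=
        measureReal_mono fun x hx => hx k
      rw [zero_add]
      by_contra hcon
      nlinarith
    filter_upwards [measure_eq_zero_iff_ae_notMem.1 ((measureReal_eq_zero_iff).1 hz)] with x hx
    simpa using hx
  have key' : ∀ᵐ x ∂μ, ∀ m : ℕ, ∃ k, f k x < 1 / ((m : ℝ) + 1) :=
    ae_all_iff.2 fun m => key _ (by positivity)
  filter_upwards [key'] with x hx ε hε
  obtain ⟨m, hm⟩ := exists_nat_one_div_lt hε
  obtain ⟨k, hk⟩ := hx m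
  exact ⟨k, hk.trans hm⟩

/-- An integrable function that does not increase along the orbits is invariant. -/
theorem MeasureTheory.MeasurePreserving.ae_comp_eq_of_ae_comp_le
    (hT : MeasurePreserving T μ μ) (hg : Integrable g μ) (hle : ∀ᵐ x ∂μ, g (T x) ≤ g x) :
    ∀ᵐ x ∂μ, g (T x) = g x := by
  have hi := hT.integrable_fun_comp hg
  have h := (integral_eq_zero_iff_of_nonneg_ae (f := fun x => g x - g (T x))
    (hle.mono fun x hx => sub_nonneg.2 hx) (hg.sub hi)).1 (by
      rw [integral_sub hg hi, hT.integral_comp_of_integrable hg, sub_self])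
  filter_upwards [h] with x hx
  have : g x - g (T x) = 0 := hx
  linarith

end ErgodicTheorem

namespace ShiftSpace

open scoped ENNReal

/-! ### Words and their concatenation. -/

section Words

variable {A : Type*}

@[simp] theorem length_initialWord (x : ℕ → A) (n : ℕ) : (initialWord x n).length = n := by
  simp [initialWord]

@[simp] theorem initialWord_zero (x : ℕ → A) : initialWord x 0 = [] := by simp [initialWord]

theorem initialWord_succ (x : ℕ → A) (n : ℕ) :
    initialWord x (n + 1) = x 0 :: initialWord (shift x) n := by
  simp [initialWord, List.ofFn_succ, shift]

theorem initialWord_add (x : ℕ → A) (m n : ℕ) :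
    initialWord x (m + n) = initialWord x m ++ initialWord (shift^[m] x) n := by
  induction m generalizing x with
  | zero => simp
  | succ m ih =>
    rw [Nat.add_right_comm, initialWord_succ, ih, initialWord_succ x m, Function.iterate_succ_apply]
    rfl

theorem take_initialWord (x : ℕ → A) (k n : ℕ) :
    (initialWord x n).take k = initialWord x (min k n) := by
  obtain ⟨m, hm⟩ := Nat.exists_eq_add_of_le (min_le_right k n)
  conv_lhs => rw [hm, initialWord_add]
  rcases le_total k n with h | h
  · rw [min_eq_left h, List.take_left' (length_initialWord x k)]
  · rw [min_eq_right h] at hm ⊢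
    obtain rfl : m = 0 := by omega
    simp [List.take_of_length_le, h]

/-- The first word of a factorization of an initial word, and the remaining word. -/
theorem eq_initialWord_of_append_eq {x : ℕ → A} {N : ℕ} {u v : List A}
    (h : u ++ v = initialWord x N) :
    u = initialWord x u.length ∧ v = initialWord (shift^[u.length] x) v.length ∧
      u.length + v.length = N := by
  have hN : u.length + v.length = N := by simpa using congrArg List.length h
  rw [← hN, initialWord_add] at h
  obtain ⟨h1, h2⟩ := List.append_inj h (by simp)
  exact ⟨h1, h2, hN⟩

theorem length_le_length_flatten {l : List (List A)} (h : ∀ w ∈ l, w ≠ []) :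
    l.length ≤ l.flatten.length := by
  induction l with
  | nil => simp
  | cons w l ih =>
    have h1 := ih fun u hu => h u (List.mem_cons_of_mem _ hu)
    have h2 := List.length_pos_iff.2 (h w List.mem_cons_self)
    simp only [List.length_cons, List.flatten_cons, List.length_append]
    omega

/-- A bound for a functional of the words of a sequence, summed over the blocks of a parsing. -/
theorem sum_map_blocks_le {F : List A → ℝ} {s : (ℕ → A) → ℝ} {K : ℝ} {x : ℕ → A}
    (h : ∀ j n, 0 < n → F (initialWord (shift^[j] x) n) ≤ K + birkhoffSum shift s n (shift^[j] x))
    {l : List (List A)} {N : ℕ} (hl : ∀ w ∈ l, w ≠ []) (hN : l.flatten = initialWord x N) :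
    (l.map F).sum ≤ K * l.length + birkhoffSum shift s N x := by
  induction l generalizing x N with
  | nil =>
    obtain rfl : N = 0 := by simpa using (congrArg List.length hN).symm
    simp
  | cons w l ih =>
    rw [List.flatten_cons] at hN
    obtain ⟨h1, h2, h3⟩ := eq_initialWord_of_append_eq hN
    have h4 := h 0 w.length (List.length_pos_iff.2 (hl w List.mem_cons_self))
    rw [Function.iterate_zero_apply, ← h1] at h4
    have h5 := ih (x := shift^[w.length] x) (fun j n hn => by
      rw [← Function.iterate_add_apply]; exact h _ n hn)
      (fun u hu => hl u (List.mem_cons_of_mem _ hu)) h2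
    rw [← h3, birkhoffSum_add]
    simp only [List.map_cons, List.sum_cons, List.length_cons]
    push_cast
    linarith

theorem mem_cylinder_initialWord (x : ℕ → A) (n : ℕ) : x ∈ cylinder (initialWord x n) := by
  simp [cylinder]

theorem mem_cylinder_iff {x : ℕ → A} {w : List A} :
    x ∈ cylinder w ↔ initialWord x w.length = w := Iff.rfl

theorem cylinder_append (u v : List A) :
    cylinder (u ++ v) = cylinder u ∩ shift^[u.length] ⁻¹' cylinder v := by
  ext x
  rw [Set.mem_inter_iff, Set.mem_preimage, mem_cylinder_iff, mem_cylinder_iff, mem_cylinder_iff,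
    List.length_append, initialWord_add]
  exact ⟨fun h => List.append_inj h (by simp), fun h => by rw [h.1, h.2]⟩

theorem cylinder_cons (a : A) (v : List A) :
    cylinder (a :: v) = {x | x 0 = a} ∩ shift ⁻¹' cylinder v := by
  ext x
  simp [mem_cylinder_iff, initialWord_succ]

@[simp] theorem cylinder_nil : cylinder ([] : List A) = Set.univ := by ext; simp [mem_cylinder_iff]

end Words

/-! ### Sums over all words of a given length. -/

section WordSum

variable {A : Type*} [Fintype A]

/-- The sum of a functional over all words of length `n`. -/
noncomputable def wordSum (n : ℕ) (F : List A → ℝ≥0∞) : ℝ≥0∞ := ∑ a : Fin n → A, F (List.ofFn a)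

theorem wordSum_mono {n : ℕ} {F G : List A → ℝ≥0∞} (h : ∀ w, w.length = n → F w ≤ G w) :
    wordSum n F ≤ wordSum n G :=
  Finset.sum_le_sum fun a _ => h _ (by simp)

theorem wordSum_congr {n : ℕ} {F G : List A → ℝ≥0∞} (h : ∀ w, w.length = n → F w = G w) :
    wordSum n F = wordSum n G :=
  Finset.sum_congr rfl fun a _ => h _ (by simp)

theorem wordSum_zero (F : List A → ℝ≥0∞) : wordSum 0 F = F [] := by simp [wordSum]

theorem wordSum_succ (n : ℕ) (F : List A → ℝ≥0∞) :
    wordSum (n + 1) F = wordSum n fun v => ∑ a, F (a :: v) := by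
  unfold wordSum
  rw [← (Fin.consEquiv fun _ : Fin (n + 1) => A).sum_comp, Fintype.sum_prod_type,
    Finset.sum_comm]
  refine Finset.sum_congr rfl fun v _ => Finset.sum_congr rfl fun a _ => ?_
  congr 1
  exact List.ofFn_cons a v

theorem wordSum_add (m n : ℕ) (F : List A → ℝ≥0∞) :
    wordSum (m + n) F = wordSum m fun u => wordSum n fun v => F (u ++ v) := by
  unfold wordSum
  rw [← (Fin.appendEquiv m n).sum_comp, Fintype.sum_prod_type]
  refine Finset.sum_congr rfl fun u _ => Finset.sum_congr rfl fun v _ => ?_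
  congr 1
  exact List.ofFn_fin_append u v

theorem wordSum_mul_left (n : ℕ) (c : ℝ≥0∞) (F : List A → ℝ≥0∞) :
    (wordSum n fun w => c * F w) = c * wordSum n F := (Finset.mul_sum _ _ _).symm

theorem wordSum_mul_right (n : ℕ) (c : ℝ≥0∞) (F : List A → ℝ≥0∞) :
    (wordSum n fun w => F w * c) = wordSum n F * c := (Finset.sum_mul _ _ _).symm

theorem wordSum_finset_sum {ι : Type*} (s : Finset ι) (n : ℕ) (F : ι → List A → ℝ≥0∞) :
    (wordSum n fun w => ∑ i ∈ s, F i w) = ∑ i ∈ s, wordSum n (F i) := Finset.sum_comm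

theorem wordSum_one (n : ℕ) : wordSum n (fun _ : List A => 1) = (Fintype.card A : ℝ≥0∞) ^ n := by
  simp [wordSum]

end WordSum

/-! ### Cylinder probabilities and integrals of functions of finitely many letters. -/

section Measure

variable {A : Type*} [Fintype A] [MeasurableSpace A] [MeasurableSingletonClass A]

theorem measurable_shift : Measurable (shift : (ℕ → A) → (ℕ → A)) :=
  measurable_pi_lambda _ fun k => measurable_pi_apply (k + 1)

theorem measurableSet_cylinder (w : List A) : MeasurableSet (cylinder w) := by
  induction w with
  | nil => simp
  | cons a v ih =>
    rw [cylinder_cons]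
    exact (measurable_pi_apply 0 (measurableSet_singleton a)).inter (measurable_shift ih)

theorem measurable_restrict_fin (n : ℕ) : Measurable fun (x : ℕ → A) (i : Fin n) => x i :=
  measurable_pi_lambda _ fun _ => measurable_pi_apply _

/-- A function of the first `n` letters is measurable. -/
theorem measurable_comp_initialWord {β : Type*} [MeasurableSpace β] (F : List A → β) (n : ℕ) :
    Measurable fun x : ℕ → A => F (initialWord x n) :=
  (measurable_of_finite fun a : Fin n → A => F (List.ofFn a)).comp (measurable_restrict_fin n)

theorem preimage_restrict_fin {n : ℕ} (a : Fin n → A) :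
    (fun (x : ℕ → A) (i : Fin n) => x i) ⁻¹' {a} = cylinder (List.ofFn a) := by
  ext x
  have : initialWord x (List.ofFn a).length = initialWord x n := by simp
  rw [mem_cylinder_iff, this, initialWord, List.ofFn_inj]
  rfl

variable {P : Measure (ℕ → A)}

theorem lintegral_comp_initialWord (F : List A → ℝ≥0∞) (n : ℕ) :
    ∫⁻ x, F (initialWord x n) ∂P = wordSum n fun w => P (cylinder w) * F w := by
  have h := lintegral_map (μ := P) (measurable_of_finite fun a : Fin n → A => F (List.ofFn a))
    (measurable_restrict_fin n)
  rw [lintegral_fintype] at h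
  refine h.symm.trans (Finset.sum_congr rfl fun a _ => ?_)
  rw [Measure.map_apply (measurable_restrict_fin n) (measurableSet_singleton a),
    preimage_restrict_fin, mul_comm]

variable [IsProbabilityMeasure P]

theorem integrable_comp_initialWord (F : List A → ℝ) (n : ℕ) :
    Integrable (fun x => F (initialWord x n)) P := by
  have : Integrable (fun a : Fin n → A => F (List.ofFn a))
      (P.map fun (x : ℕ → A) (i : Fin n) => x i) :=
    have := Measure.isProbabilityMeasure_map (μ := P) (measurable_restrict_fin n).aemeasurable
    .of_finite
  exact this.comp_measurable (measurable_restrict_fin n)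

theorem integral_comp_initialWord (F : List A → ℝ) (n : ℕ) :
    ∫ x, F (initialWord x n) ∂P
      = ∑ a : Fin n → A, P.real (cylinder (List.ofFn a)) * F (List.ofFn a) := by
  have := Measure.isProbabilityMeasure_map (μ := P) (measurable_restrict_fin (A := A) n).aemeasurable
  have h := integral_map (μ := P) (measurable_restrict_fin n).aemeasurable
    (measurable_of_finite fun a : Fin n → A => F (List.ofFn a)).aestronglyMeasurable
  rw [integral_fintype .of_finite] at h
  refine h.symm.trans (Finset.sum_congr rfl fun a _ => ?_)
  rw [measureReal_def, Measure.map_apply (measurable_restrict_fin n) (measurableSet_singleton a),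
    preimage_restrict_fin, measureReal_def, smul_eq_mul]

theorem integral_negLogProb (n : ℕ) :
    ∫ x, negLogProb P (initialWord x n) ∂P = blockEntropy P n := by
  rw [integral_comp_initialWord, blockEntropy, ← Finset.sum_neg_distrib]
  exact Finset.sum_congr rfl fun a _ => by rw [negLogProb]; ring

omit [Fintype A] [MeasurableSingletonClass A] in
theorem negLogProb_nonneg (w : List A) : 0 ≤ negLogProb P w :=
  neg_nonneg.2 (Real.log_nonpos measureReal_nonneg measureReal_le_one)

omit [Fintype A] [MeasurableSingletonClass A] in
theorem negLogProb_nil : negLogProb P [] = 0 := by simp [negLogProb]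

omit [Fintype A] [MeasurableSingletonClass A] in
theorem ofReal_exp_neg_negLogProb {w : List A} (h : P (cylinder w) ≠ 0) :
    ENNReal.ofReal (Real.exp (-negLogProb P w)) = P (cylinder w) := by
  have : 0 < P.real (cylinder w) := ENNReal.toReal_pos h (measure_ne_top _ _)
  rw [negLogProb, neg_neg, Real.exp_log this, measureReal_def,
    ENNReal.ofReal_toReal (measure_ne_top _ _)]

omit [MeasurableSingletonClass A] in
-- There are finitely many words of length at most `k`; null words contribute `0`, because `Real.log
-- 0 = 0`.
theorem exists_negLogProb_le (k : ℕ) :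
    ∃ L, 0 ≤ L ∧ ∀ (x : ℕ → A) (n : ℕ), n ≤ k → negLogProb P (initialWord x n) ≤ L := by
  refine ⟨∑ m ∈ Finset.range (k + 1), ∑ a : Fin m → A, negLogProb P (List.ofFn a),
    Finset.sum_nonneg fun m _ => Finset.sum_nonneg fun a _ => negLogProb_nonneg _, ?_⟩
  intro x n hn
  refine le_trans ?_ (Finset.single_le_sum
    (f := fun m => ∑ a : Fin m → A, negLogProb P (List.ofFn a))
    (fun m _ => Finset.sum_nonneg fun a _ => negLogProb_nonneg _)
    (Finset.mem_range.2 (Nat.lt_succ_of_le hn)))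
  exact Finset.single_le_sum (f := fun a : Fin n → A => negLogProb P (List.ofFn a))
    (fun a _ => negLogProb_nonneg _) (Finset.mem_univ fun i : Fin n => x i)

theorem measure_cylinder_append_le_left (u v : List A) :
    P (cylinder (u ++ v)) ≤ P (cylinder u) := by
  rw [cylinder_append]; exact measure_mono Set.inter_subset_left

variable (hP : MeasurePreserving (shift : (ℕ → A) → (ℕ → A)) P P)
include hP

theorem measure_cylinder_append_le_right (u v : List A) :
    P (cylinder (u ++ v)) ≤ P (cylinder v) := by
  rw [cylinder_append]
  refine (measure_mono Set.inter_subset_right).trans_eq ?_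
  exact (hP.iterate _).measure_preimage (measurableSet_cylinder v).nullMeasurableSet

theorem sum_measure_cylinder_cons (v : List A) :
    ∑ a, P (cylinder (a :: v)) = P (cylinder v) := by
  rw [← hP.measure_preimage (measurableSet_cylinder v).nullMeasurableSet]
  rw [← measure_biUnion_finset]
  · congr 1
    ext x
    simp [cylinder_cons]
  · intro a _ b _ hab
    refine Set.disjoint_left.2 fun x hx hx' => hab ?_
    simp only [cylinder_cons] at hx hx'
    exact hx.1.symm.trans hx'.1
  · exact fun a _ => measurableSet_cylinder _

theorem wordSum_measure_cylinder (n : ℕ) : (wordSum n fun w => P (cylinder w)) = 1 := by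
  induction n with
  | zero => simp [wordSum_zero]
  | succ n ih => rw [wordSum_succ]; simp_rw [sum_measure_cylinder_cons hP]; exact ih

omit [Fintype A] [MeasurableSingletonClass A] [IsProbabilityMeasure P] in
theorem ae_forall_iterate {p : (ℕ → A) → Prop} (h : ∀ᵐ x ∂P, p x) :
    ∀ᵐ x ∂P, ∀ j, p (shift^[j] x) :=
  ae_all_iff.2 fun j => (hP.iterate j).quasiMeasurePreserving.ae h

omit hP [IsProbabilityMeasure P] [MeasurableSingletonClass A] in
-- There are countably many words, so the null cylinders have a null union. This removes the points
-- where `negLogProb` takes the default value `0` instead of `∞`.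
theorem ae_measure_cylinder_ne_zero :
    ∀ᵐ x ∂P, ∀ n, P (cylinder (initialWord x n)) ≠ 0 := by
  have : ∀ᵐ x ∂P, ∀ w : List A, P (cylinder w) = 0 → x ∉ cylinder w := by
    refine ae_all_iff.2 fun w => ?_
    by_cases hw : P (cylinder w) = 0
    · filter_upwards [measure_eq_zero_iff_ae_notMem.1 hw] with x hx _ using hx
    · exact ae_of_all _ fun x h => absurd h hw
  filter_upwards [this] with x hx n h0
  exact hx _ h0 (mem_cylinder_initialWord x n)

end Measure

/-! ### Almost sure comparison of `P` with other weights on words. -/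

section RatioSum

variable {A : Type*} [Fintype A] [MeasurableSpace A] [MeasurableSingletonClass A]
  {P : Measure (ℕ → A)} [IsProbabilityMeasure P]

/-- If the total mass of `Q` on words of length `n` grows slower than `exp (θ n)`, then `Q / P` grows
at most like `exp (θ n)` along almost every sequence, up to an integrable factor. -/
theorem exists_integrable_negLogProb_le (Q : List A → ℝ≥0∞) (θ : ℝ)
    (hQ : ∑' n, ENNReal.ofReal (Real.exp (-θ)) ^ n * wordSum n Q ≠ ∞) :
    ∃ Z : (ℕ → A) → ℝ, Integrable Z P ∧ (∀ x, 1 ≤ Z x) ∧ ∀ᵐ x ∂P, ∀ (n : ℕ) (q : ℝ),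
      ENNReal.ofReal (Real.exp (-q)) ≤ Q (initialWord x n) →
        negLogProb P (initialWord x n) ≤ q + θ * n + Real.log (Z x) := by
  set r := ENNReal.ofReal (Real.exp (-θ)) with hr
  -- `Q / P` has mean at most the mass of `Q` on words of length `n`, so `Y` is integrable. Each
  -- term is at most `Y`; taking logarithms gives the bound for all `n` at once.
  set Y : (ℕ → A) → ℝ≥0∞ := fun x =>
    ∑' n, r ^ n * (Q (initialWord x n) / P (cylinder (initialWord x n))) with hY
  have hmeas : ∀ n, Measurable fun x : ℕ → A =>
      r ^ n * (Q (initialWord x n) / P (cylinder (initialWord x n))) := fun n =>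
    measurable_comp_initialWord (fun w => r ^ n * (Q w / P (cylinder w))) n
  have hYm : Measurable Y := Measurable.tsum hmeas
  have hint : ∫⁻ x, Y x ∂P ≠ ∞ := by
    refine ne_top_of_le_ne_top hQ ?_
    rw [lintegral_tsum fun n => (hmeas n).aemeasurable]
    refine ENNReal.tsum_le_tsum fun n => ?_
    rw [lintegral_comp_initialWord (fun w => r ^ n * (Q w / P (cylinder w))), ← wordSum_mul_left]
    refine wordSum_mono fun w _ => ?_
    rw [mul_left_comm]
    gcongr
    exact ENNReal.mul_div_le
  refine ⟨fun x => 1 + (Y x).toReal, (integrable_const 1).add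
    (integrable_toReal_of_lintegral_ne_top hYm.aemeasurable hint),
    fun x => le_add_of_nonneg_right ENNReal.toReal_nonneg, ?_⟩
  filter_upwards [ae_lt_top hYm hint, ae_measure_cylinder_ne_zero (P := P)] with x hx hpos n q hq
  have h1 : r ^ n * (Q (initialWord x n) / P (cylinder (initialWord x n))) ≤ Y x :=
    ENNReal.le_tsum n
  have h2 : r ^ n * (ENNReal.ofReal (Real.exp (-q)) / P (cylinder (initialWord x n))) ≤ Y x :=
    le_trans (by gcongr) h1
  rw [← ofReal_exp_neg_negLogProb (hpos n), hr, ← ENNReal.ofReal_pow (Real.exp_pos _).le,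
    ← ENNReal.ofReal_div_of_pos (Real.exp_pos _), ← ENNReal.ofReal_mul (by positivity),
    ← Real.exp_nat_mul, ← Real.exp_sub, ← Real.exp_add] at h2
  have h3 := ENNReal.toReal_mono hx.ne h2
  rw [ENNReal.toReal_ofReal (Real.exp_pos _).le] at h3
  have h4 := (Real.le_log_iff_exp_le (by positivity)).2
    (h3.trans (le_add_of_nonneg_left zero_le_one : _ ≤ 1 + (Y x).toReal))
  linarith

/-- This trades `log Z` at the start of a block for a constant, paid once per block, and a small
multiple of `Z`, which the ergodic theorem controls along the orbit. -/
theorem log_le_add_exp_neg_mul {z : ℝ} (hz : 0 < z) (K : ℝ) :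
    Real.log z ≤ K + Real.exp (-K) * z := by
  have h := Real.log_le_sub_one_of_pos (show 0 < Real.exp (-K) * z by positivity)
  rw [Real.log_mul (Real.exp_pos _).ne' hz.ne', Real.log_exp] at h
  linarith

theorem tsum_ofReal_exp_pow_ne_top {θ : ℝ} (hθ : 0 < θ) :
    ∑' n, ENNReal.ofReal (Real.exp (-θ)) ^ n ≠ ∞ := by
  rw [ENNReal.tsum_geometric, ENNReal.inv_ne_top]
  exact (tsub_pos_of_lt (ENNReal.ofReal_lt_one.2 (Real.exp_lt_one_iff.2 (by linarith)))).ne'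

/-- `-log P([x_1^n])` is at most linear in `n`, up to the logarithm of an integrable function. -/
theorem exists_integrable_negLogProb_le_linear :
    ∃ (θ : ℝ) (Z : (ℕ → A) → ℝ), 0 ≤ θ ∧ Integrable Z P ∧ (∀ x, 1 ≤ Z x) ∧ ∀ᵐ x ∂P, ∀ n : ℕ,
      negLogProb P (initialWord x n) ≤ θ * n + Real.log (Z x) := by
  set c : ℝ := (Fintype.card A : ℝ) with hc
  have hc0 : 0 ≤ c := by positivity
  -- With `Q = 1` the mass is `c ^ n`, and `c ≤ exp c` leaves a geometric series of ratio at most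
  -- `exp (-1)`.
  have h : ∑' n, ENNReal.ofReal (Real.exp (-(c + 1))) ^ n * wordSum n (fun _ : List A => 1) ≠ ∞ := by
    simp_rw [wordSum_one, ← mul_pow]
    refine ne_top_of_le_ne_top (tsum_ofReal_exp_pow_ne_top one_pos) ?_
    refine ENNReal.tsum_le_tsum fun n => ?_
    gcongr
    rw [← ENNReal.ofReal_natCast, ← ENNReal.ofReal_mul (Real.exp_pos _).le]
    refine ENNReal.ofReal_le_ofReal ?_
    have : c ≤ Real.exp c := by linarith [Real.add_one_le_exp c]
    calc Real.exp (-(c + 1)) * c ≤ Real.exp (-(c + 1)) * Real.exp c := by gcongr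
      _ = Real.exp (-1) := by rw [← Real.exp_add]; ring_nf
  obtain ⟨Z, h1, h2, h3⟩ := exists_integrable_negLogProb_le (P := P) _ _ h
  refine ⟨c + 1, Z, by positivity, h1, h2, ?_⟩
  filter_upwards [h3] with x hx n
  simpa using hx n 0 (by simp)

end RatioSum

/-! ### Markov approximations and conditional information. -/

section Markov

variable {A : Type*} [MeasurableSpace A]

/-- The probability of a word under the Markov approximation of order `k` of `P`, with transition
probabilities backward in time. -/
noncomputable def markovWeight (P : Measure (ℕ → A)) (k : ℕ) : List A → ℝ≥0∞
  | [] => 1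
  | a :: v => P (cylinder (a :: v.take k)) / P (cylinder (v.take k)) * markovWeight P k v

/-- The information of the first letter given the next `k` letters. -/
noncomputable def condInfo (P : Measure (ℕ → A)) (k : ℕ) (x : ℕ → A) : ℝ :=
  negLogProb P (initialWord x (k + 1)) - negLogProb P (initialWord (shift x) k)

variable [Fintype A] [MeasurableSingletonClass A] {P : Measure (ℕ → A)} [IsProbabilityMeasure P]
  (hP : MeasurePreserving (shift : (ℕ → A) → (ℕ → A)) P P)
include hP

/-- By stationarity the transition probabilities to the preceding letter sum to `1`, or to `0` after
a null word, since `0 / 0 = 0`. -/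
theorem wordSum_markovWeight_le (k n : ℕ) : wordSum n (markovWeight P k) ≤ 1 := by
  induction n with
  | zero => simp [wordSum_zero, markovWeight]
  | succ n ih =>
    rw [wordSum_succ]
    refine (wordSum_mono fun v _ => ?_).trans ih
    simp_rw [markovWeight, div_eq_mul_inv]
    rw [← Finset.sum_mul, ← Finset.sum_mul, sum_measure_cylinder_cons hP, ← div_eq_mul_inv]
    exact mul_le_of_le_one_left' ENNReal.div_self_le_one

theorem condInfo_nonneg {x : ℕ → A} (hx : ∀ n, P (cylinder (initialWord x n)) ≠ 0) (k : ℕ) :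
    0 ≤ condInfo P k x := by
  rw [condInfo, sub_nonneg, negLogProb, negLogProb, neg_le_neg_iff]
  refine Real.log_le_log (ENNReal.toReal_pos (hx _) (measure_ne_top _ _)) ?_
  rw [initialWord_succ]
  exact ENNReal.toReal_mono (measure_ne_top _ _) (measure_cylinder_append_le_right hP [x 0] _)

theorem integrable_condInfo (k : ℕ) : Integrable (condInfo P k) P :=
  (integrable_comp_initialWord _ _).sub
    (hP.integrable_fun_comp (integrable_comp_initialWord (negLogProb P) k))

theorem integral_condInfo (k : ℕ) :
    ∫ x, condInfo P k x ∂P = blockEntropy P (k + 1) - blockEntropy P k := by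
  have hi := integrable_comp_initialWord (P := P) (negLogProb P) k
  rw [← integral_negLogProb, ← integral_negLogProb, ← hP.integral_comp_of_integrable hi]
  exact integral_sub (integrable_comp_initialWord _ _) (hP.integrable_fun_comp hi)

/-- A position followed by at least `k` letters contributes exactly `exp (-condInfo P k)`. Each of
the last `k` positions has fewer letters to condition on; its factor is at least the probability of
the remaining word, hence at least `exp (-L)`. -/
theorem le_markovWeight {k : ℕ} {L : ℝ}
    (hL : ∀ (x : ℕ → A) (n : ℕ), n ≤ k → negLogProb P (initialWord x n) ≤ L) {x : ℕ → A}
    (hx : ∀ j n, P (cylinder (initialWord (shift^[j] x) n)) ≠ 0) (n : ℕ) :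
    ENNReal.ofReal (Real.exp (-(L * min n k + birkhoffSum shift (condInfo P k) n x)))
      ≤ markovWeight P k (initialWord x n) := by
  induction n generalizing x with
  | zero => simp [markovWeight]
  | succ n ih =>
    have h0 := hx 0
    have h1 := hx 1
    rw [Function.iterate_zero_apply] at h0
    rw [Function.iterate_one] at h1
    have h2 := ih (x := shift x) fun j m => by
      rw [← Function.iterate_succ_apply]; exact hx _ m
    rw [initialWord_succ, markovWeight, take_initialWord, ← initialWord_succ,
      ← ofReal_exp_neg_negLogProb (h0 _), ← ofReal_exp_neg_negLogProb (h1 _),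
      ← ENNReal.ofReal_div_of_pos (Real.exp_pos _), ← Real.exp_sub]
    refine le_trans ?_ (mul_le_mul_right h2 _)
    rw [← ENNReal.ofReal_mul (Real.exp_pos _).le, ← Real.exp_add, birkhoffSum_succ']
    refine ENNReal.ofReal_le_ofReal (Real.exp_le_exp.2 ?_)
    rcases le_or_gt k n with h | h
    · rw [min_eq_left h, min_eq_right (by exact_mod_cast h.trans n.le_succ),
        min_eq_right (by exact_mod_cast h), condInfo]
      linarith
    · rw [min_eq_right h.le, min_eq_left (by exact_mod_cast h),
        min_eq_left (by exact_mod_cast h.le)]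
      have h3 := hL x (n + 1) h
      have h4 := condInfo_nonneg hP h0 k
      have h5 := negLogProb_nonneg (P := P) (initialWord (shift x) n)
      push_cast
      linarith

/-- Comparison of `P` with its Markov approximation of order `k`. -/
theorem exists_integrable_negLogProb_le_condInfo (k : ℕ) {θ : ℝ} (hθ : 0 < θ) :
    ∃ (L : ℝ) (Z : (ℕ → A) → ℝ), Integrable Z P ∧ (∀ x, 1 ≤ Z x) ∧ ∀ᵐ x ∂P, ∀ n : ℕ,
      negLogProb P (initialWord x n)
        ≤ L + birkhoffSum shift (condInfo P k) n x + θ * n + Real.log (Z x) := by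
  obtain ⟨L, hL0, hL⟩ := exists_negLogProb_le (P := P) k
  obtain ⟨Z, h1, h2, h3⟩ := exists_integrable_negLogProb_le (P := P) (markovWeight P k) θ (by
    refine ne_top_of_le_ne_top (tsum_ofReal_exp_pow_ne_top hθ) (ENNReal.tsum_le_tsum fun n => ?_)
    exact mul_le_of_le_one_right' (wordSum_markovWeight_le hP k n))
  refine ⟨L * k, Z, h1, h2, ?_⟩
  filter_upwards [h3, ae_forall_iterate hP ae_measure_cylinder_ne_zero] with x hx hpos n
  have h4 := hx n _ (le_markovWeight hP hL hpos n)
  have h5 : L * (min n k : ℕ) ≤ L * k := by gcongr; exact min_le_right _ _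
  linarith

end Markov

/-! ### The total weight of all parsings, and the lower bound for block sums. -/

section ParsingWeight

variable {A : Type*} [MeasurableSpace A]

/-- The sum of `∏ δ P([w_i])` over the parsings `w_1, w_2, …` of a word into at most `n` blocks. -/
noncomputable def parsingWeight (P : Measure (ℕ → A)) (δ : ℝ≥0∞) : ℕ → List A → ℝ≥0∞
  | 0, w => if w.length = 0 then 1 else 0
  | n + 1, w => (if w.length = 0 then 1 else 0) + ∑ i ∈ Finset.range w.length,
      δ * (P (cylinder (w.take (i + 1))) * parsingWeight P δ n (w.drop (i + 1)))

theorem prod_le_parsingWeight (P : Measure (ℕ → A)) (δ : ℝ≥0∞) {l : List (List A)}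
    (hl : ∀ w ∈ l, w ≠ []) {n : ℕ} (hn : l.length ≤ n) :
    (l.map fun w => δ * P (cylinder w)).prod ≤ parsingWeight P δ n l.flatten := by
  induction l generalizing n with
  | nil => cases n <;> simp [parsingWeight]
  | cons w l ih =>
    obtain ⟨n, rfl⟩ : ∃ m, n = m + 1 := Nat.exists_eq_succ_of_ne_zero (by
      rw [List.length_cons] at hn; omega)
    have hw := List.length_pos_iff.2 (hl w List.mem_cons_self)
    have h1 := ih (fun u hu => hl u (List.mem_cons_of_mem _ hu)) (Nat.le_of_succ_le_succ hn)
    rw [parsingWeight]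
    refine le_trans ?_ le_add_self
    -- The index `i` stands for a first block of length `i + 1`.
    refine le_trans ?_ (Finset.single_le_sum (a := w.length - 1) (fun _ _ => zero_le)
      (Finset.mem_range.2 ?_))
    · rw [Nat.sub_add_cancel hw, List.flatten_cons, List.take_left' rfl, List.drop_left' rfl,
        List.map_cons, List.prod_cons, mul_assoc]
      gcongr
    · simp only [List.flatten_cons, List.length_append]; omega

variable [Fintype A] [MeasurableSingletonClass A] {P : Measure (ℕ → A)} [IsProbabilityMeasure P]
  (hP : MeasurePreserving (shift : (ℕ → A) → (ℕ → A)) P P)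
include hP

/-- For fixed block lengths the products of block probabilities sum to `1`, so only the compositions
of `N` are counted, with weight `δ` per part. Splitting off the first part gives the geometric sum
`hgeom`. -/
theorem wordSum_parsingWeight_le (δ : ℝ≥0∞) (n N : ℕ) :
    wordSum N (parsingWeight P δ n) ≤ (1 + δ) ^ N := by
  have hempty : ∀ N, (wordSum N fun w : List A => if w.length = 0 then (1 : ℝ≥0∞) else 0) ≤ 1 := by
    intro N
    rcases Nat.eq_zero_or_pos N with rfl | hN
    · simp [wordSum_zero]
    · rw [wordSum_congr (G := fun _ => 0) fun w hw => by rw [if_neg (by omega)]]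
      simp [wordSum]
  induction n generalizing N with
  | zero => exact (hempty N).trans (one_le_pow_of_one_le' le_self_add N)
  | succ n ih =>
    have hgeom : 1 + ∑ i ∈ Finset.range N, δ * (1 + δ) ^ i = (1 + δ) ^ N := by
      clear ih
      induction N with
      | zero => simp
      | succ N ih => rw [Finset.sum_range_succ, ← add_assoc, ih, pow_succ]; ring
    rw [wordSum_congr (G := fun w => (if w.length = 0 then 1 else 0) + ∑ i ∈ Finset.range N,
      δ * (P (cylinder (w.take (i + 1))) * parsingWeight P δ n (w.drop (i + 1))))
      fun w hw => by rw [parsingWeight, hw]]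
    have hadd : ∀ F G : List A → ℝ≥0∞, (wordSum N fun w => F w + G w) = wordSum N F + wordSum N G :=
      fun F G => Finset.sum_add_distrib
    rw [hadd, wordSum_finset_sum, ← hgeom]
    refine add_le_add (hempty N) ?_
    rw [← Finset.sum_range_reflect (fun i => δ * (1 + δ) ^ i)]
    refine Finset.sum_le_sum fun i hi => ?_
    rw [Finset.mem_range] at hi
    rw [wordSum_mul_left]
    gcongr
    obtain ⟨m, rfl⟩ := Nat.exists_eq_add_of_le (show i + 1 ≤ N from hi)
    rw [wordSum_add, wordSum_congr (G := fun u => P (cylinder u) * wordSum m (parsingWeight P δ n))]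
    · rw [wordSum_mul_right, wordSum_measure_cylinder hP, one_mul]
      refine (ih m).trans_eq ?_
      congr 1; omega
    · intro u hu
      rw [← wordSum_mul_left]
      refine wordSum_congr fun v _ => ?_
      rw [List.take_left' hu, List.drop_left' hu]

omit [Fintype A] [MeasurableSingletonClass A] hP in
theorem prod_eq_ofReal_exp (κ : ℝ) {l : List (List A)} (hl : ∀ w ∈ l, P (cylinder w) ≠ 0) :
    (l.map fun w => ENNReal.ofReal (Real.exp (-κ)) * P (cylinder w)).prod
      = ENNReal.ofReal (Real.exp (-(l.map fun w => negLogProb P w + κ).sum)) := by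
  induction l with
  | nil => simp
  | cons w l ih =>
    rw [List.map_cons, List.prod_cons, ih fun u hu => hl u (List.mem_cons_of_mem _ hu),
      ← ofReal_exp_neg_negLogProb (hl w List.mem_cons_self),
      ← ENNReal.ofReal_mul (Real.exp_pos _).le, ← ENNReal.ofReal_mul (by positivity),
      ← Real.exp_add, ← Real.exp_add, List.map_cons, List.sum_cons]
    ring_nf

theorem measure_cylinder_ne_zero_of_mem {l : List (List A)} (h : P (cylinder l.flatten) ≠ 0) :
    ∀ w ∈ l, P (cylinder w) ≠ 0 := by
  induction l with
  | nil => simp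
  | cons u l ih =>
    rw [List.flatten_cons] at h
    intro w hw
    rcases List.mem_cons.1 hw with rfl | hw
    · exact fun h0 => h (le_antisymm ((measure_cylinder_append_le_left _ _).trans h0.le) zero_le)
    · exact ih (fun h0 => h (le_antisymm
        ((measure_cylinder_append_le_right hP _ _).trans h0.le) zero_le)) w hw

/-- All parsings of `x_1^N` give an upper bound for `-log P([x_1^N])`. -/
theorem ae_negLogProb_le_sum_blocks {κ θ : ℝ} (h : Real.exp (-κ) < θ) :
    ∀ᵐ x ∂P, ∃ C : ℝ, ∀ (N : ℕ) (l : List (List A)), (∀ w ∈ l, w ≠ []) →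
      l.flatten = initialWord x N →
      negLogProb P (initialWord x N) ≤ (l.map fun w => negLogProb P w + κ).sum + θ * N + C := by
  set δ := ENNReal.ofReal (Real.exp (-κ)) with hδ
  -- Nonempty blocks number at most `w.length`, so this depth covers all parsings. The mass `(1 + δ)
  -- ^ n ≤ exp (δ n)` grows more slowly than `exp (θ n)`.
  obtain ⟨Z, -, -, hZ⟩ := exists_integrable_negLogProb_le (P := P)
    (fun w => parsingWeight P δ w.length w) θ (by
      refine ne_top_of_le_ne_top (tsum_ofReal_exp_pow_ne_top (sub_pos.2 h)) ?_
      refine ENNReal.tsum_le_tsum fun n => ?_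
      rw [wordSum_congr (G := parsingWeight P δ n) fun w hw => by rw [hw]]
      calc ENNReal.ofReal (Real.exp (-θ)) ^ n * wordSum n (parsingWeight P δ n)
          ≤ ENNReal.ofReal (Real.exp (-θ)) ^ n * (1 + δ) ^ n := by
            gcongr; exact wordSum_parsingWeight_le hP δ n n
        _ = (ENNReal.ofReal (Real.exp (-θ)) * (1 + δ)) ^ n := (mul_pow _ _ _).symm
        _ ≤ _ := by
            gcongr
            rw [hδ, ← ENNReal.ofReal_one, ← ENNReal.ofReal_add zero_le_one (Real.exp_pos _).le,
              ← ENNReal.ofReal_mul (Real.exp_pos _).le]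
            refine ENNReal.ofReal_le_ofReal ?_
            calc Real.exp (-θ) * (1 + Real.exp (-κ))
                ≤ Real.exp (-θ) * Real.exp (Real.exp (-κ)) := by
                  gcongr; linarith [Real.add_one_le_exp (Real.exp (-κ))]
              _ = _ := by rw [← Real.exp_add]; ring_nf)
  filter_upwards [hZ, ae_measure_cylinder_ne_zero (P := P)] with x hx hpos
  refine ⟨Real.log (Z x), fun N l hl hN => hx N _ ?_⟩
  rw [← prod_eq_ofReal_exp κ (measure_cylinder_ne_zero_of_mem hP (hN ▸ hpos N)), ← hN]
  exact prod_le_parsingWeight P δ hl (length_le_length_flatten hl)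

end ParsingWeight

/-! ### Almost sure bounds valid for all parsings simultaneously. -/

section Blocks

variable {A : Type*} [Fintype A] [MeasurableSpace A] [MeasurableSingletonClass A]
  {P : Measure (ℕ → A)} [IsProbabilityMeasure P]
  (hP : MeasurePreserving (shift : (ℕ → A) → (ℕ → A)) P P)
include hP

/-- The hypothesis is used at the starting point of each block. There `log Z ≤ K + exp (-K) * Z`,
and `Z` is at most its Birkhoff sum over the block; Birkhoff sums over consecutive blocks add up. -/
theorem ae_sum_blocks_le {L : ℝ} {s Z : (ℕ → A) → ℝ} (hZ : ∀ x, 1 ≤ Z x)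
    (h : ∀ᵐ x ∂P, ∀ n, negLogProb P (initialWord x n)
      ≤ L + birkhoffSum shift s n x + Real.log (Z x)) :
    ∀ᵐ x ∂P, ∀ (K : ℝ) (N : ℕ) (l : List (List A)), (∀ w ∈ l, w ≠ []) →
      l.flatten = initialWord x N → (l.map (negLogProb P)).sum
        ≤ (L + K) * l.length + birkhoffSum shift s N x
          + Real.exp (-K) * birkhoffSum shift Z N x := by
  filter_upwards [ae_forall_iterate hP h] with x hx K N l hl hN
  have hsplit : ∀ n y, birkhoffSum shift (fun y => s y + Real.exp (-K) * Z y) n y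
      = birkhoffSum shift s n y + Real.exp (-K) * birkhoffSum shift Z n y := fun n y => by
    simp only [birkhoffSum, Finset.sum_add_distrib, Finset.mul_sum]
  rw [add_assoc, ← hsplit]
  refine sum_map_blocks_le (fun j n hn => ?_) hl hN
  rw [hsplit]
  have h1 := hx j n
  have h2 := log_le_add_exp_neg_mul (zero_lt_one.trans_le (hZ (shift^[j] x))) K
  have h3 : Z (shift^[j] x) ≤ birkhoffSum shift Z n (shift^[j] x) :=
    Finset.single_le_sum (f := fun k => Z (shift^[k] (shift^[j] x)))
      (fun k _ => zero_le_one.trans (hZ _)) (Finset.mem_range.2 hn)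
  have h4 := mul_le_mul_of_nonneg_left h3 (Real.exp_pos (-K)).le
  linarith

/-- Bounding the number of blocks by `N` makes this independent of the parsing, as uniform
integrability requires. -/
theorem exists_ae_sum_blocks_le_linear :
    ∃ (θ : ℝ) (Z : (ℕ → A) → ℝ), 0 ≤ θ ∧ Integrable Z P ∧ (∀ x, 1 ≤ Z x) ∧
      ∀ᵐ x ∂P, ∀ K, 0 ≤ K → ∀ (N : ℕ) (l : List (List A)), (∀ w ∈ l, w ≠ []) →
        l.flatten = initialWord x N → (l.map (negLogProb P)).sum
          ≤ (θ + K) * N + Real.exp (-K) * birkhoffSum shift Z N x := by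
  obtain ⟨θ, Z, h0, hZi, hZ, h⟩ := exists_integrable_negLogProb_le_linear (P := P)
  refine ⟨θ, Z, h0, hZi, hZ, ?_⟩
  filter_upwards [ae_sum_blocks_le hP (L := 0) (s := fun _ => θ) hZ
    (h.mono fun x hx n => (hx n).trans_eq (by simp [birkhoffSum, mul_comm]))] with x hx K hK N l hl hN
  have h1 := hx K N l hl hN
  have h2 : (l.length : ℝ) ≤ N := by
    have := length_le_length_flatten hl
    rw [hN, length_initialWord] at this
    exact_mod_cast this
  have h3 := mul_le_mul_of_nonneg_left h2 hK
  simp only [birkhoffSum, Finset.sum_const, Finset.card_range, nsmul_eq_mul] at h1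
  rw [birkhoffSum]
  linarith

/-- The upper bound for the sum over the blocks of a parsing in terms of the conditional
information of order `k`. -/
theorem ae_sum_blocks_le_condInfo (k : ℕ) :
    ∀ᵐ x ∂P, ∀ η > 0, ∃ D : ℝ, ∀ᶠ N : ℕ in atTop, ∀ l : List (List A), (∀ w ∈ l, w ≠ []) →
      l.flatten = initialWord x N → (l.map (negLogProb P)).sum
        ≤ D * l.length + ((P[condInfo P k|MeasurableSpace.invariants shift]) x + η) * N := by
  -- The three `θ` pay for the Markov comparison, for the ergodic theorem applied to `condInfo P k`,
  -- and for `exp (-K)` times the Birkhoff sum of `Z`. `K` may depend on `x`.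
  have key : ∀ θ > 0, ∀ᵐ x ∂P, ∃ D : ℝ, ∀ᶠ N : ℕ in atTop, ∀ l : List (List A),
      (∀ w ∈ l, w ≠ []) → l.flatten = initialWord x N → (l.map (negLogProb P)).sum
        ≤ D * l.length + ((P[condInfo P k|MeasurableSpace.invariants shift]) x + 3 * θ) * N := by
    intro θ hθ
    obtain ⟨L, Z, hZi, hZ, h⟩ := exists_integrable_negLogProb_le_condInfo hP k hθ
    have hsplit : ∀ n y, birkhoffSum shift (fun y => condInfo P k y + θ) n y
        = birkhoffSum shift (condInfo P k) n y + θ * n := fun n y => by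
      simp [birkhoffSum, Finset.sum_add_distrib, mul_comm]
    filter_upwards [ae_sum_blocks_le hP (L := L) (s := fun y => condInfo P k y + θ) hZ
      (h.mono fun x hx n => (hx n).trans_eq (by rw [hsplit]; ring)),
      hP.ae_eventually_birkhoffSum_le (integrable_condInfo hP k),
      hP.ae_eventually_birkhoffSum_le hZi] with x h1 h2 h3
    set ζ := (P[Z|MeasurableSpace.invariants shift]) x
    obtain ⟨K, hK⟩ : ∃ K : ℝ, Real.exp (-K) * (ζ + 1) < θ := by
      have : Tendsto (fun K : ℝ => Real.exp (-K) * (ζ + 1)) atTop (𝓝 (0 * (ζ + 1))) :=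
        Real.tendsto_exp_neg_atTop_nhds_zero.mul_const _
      rw [zero_mul] at this
      exact (this.eventually_lt_const hθ).exists
    refine ⟨L + K, ?_⟩
    filter_upwards [h2 θ hθ, h3 1 one_pos] with N h4 h5 l hl hN
    have h6 := h1 K N l hl hN
    rw [hsplit] at h6
    have h7 := mul_le_mul_of_nonneg_left h5 (Real.exp_pos (-K)).le
    have h8 := mul_le_mul_of_nonneg_right hK.le (Nat.cast_nonneg (α := ℝ) N)
    linarith
  have key' : ∀ᵐ x ∂P, ∀ m : ℕ, _ := ae_all_iff.2 fun m : ℕ => key (1 / ((m : ℝ) + 1)) (by positivity)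
  filter_upwards [key'] with x hx η hη
  obtain ⟨m, hm⟩ := exists_nat_one_div_lt (show 0 < η / 3 by positivity)
  obtain ⟨D, hD⟩ := hx m
  refine ⟨D, hD.mono fun N hN l hl hl' => (hN l hl hl').trans ?_⟩
  gcongr
  linarith

/-- The lower bound for the sum over the blocks of a parsing. -/
theorem ae_negLogProb_le_sum_blocks_add :
    ∀ᵐ x ∂P, ∀ η > 0, ∃ D : ℝ, ∀ᶠ N : ℕ in atTop, ∀ l : List (List A), (∀ w ∈ l, w ≠ []) →
      l.flatten = initialWord x N → negLogProb P (initialWord x N)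
        ≤ (l.map (negLogProb P)).sum + D * l.length + η * N := by
  -- A charge of `m` per block lowers the error per letter to `2 * exp (-m)`; the factor `2` makes
  -- the inequality on `θ` strict.
  have key' : ∀ᵐ x ∂P, ∀ m : ℕ, _ := ae_all_iff.2 fun m : ℕ =>
    ae_negLogProb_le_sum_blocks hP (κ := m) (θ := 2 * Real.exp (-m)) (by
      linarith [Real.exp_pos (-m : ℝ)])
  filter_upwards [key'] with x hx η hη
  obtain ⟨m, hm⟩ : ∃ m : ℕ, 2 * Real.exp (-(m : ℝ)) < η := by
    have : Tendsto (fun m : ℕ => 2 * Real.exp (-(m : ℝ))) atTop (𝓝 (2 * 0)) :=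
      (Real.tendsto_exp_neg_atTop_nhds_zero.comp tendsto_natCast_atTop_atTop).const_mul 2
    rw [mul_zero] at this
    exact (this.eventually_lt_const hη).exists
  obtain ⟨C, hC⟩ := hx m
  refine ⟨m, ?_⟩
  filter_upwards [tendsto_natCast_atTop_atTop.eventually_ge_atTop (C / (η - 2 * Real.exp (-m)))]
    with N hN l hl hl'
  rw [div_le_iff₀ (by linarith)] at hN
  have h1 := hC N l hl hl'
  rw [List.sum_map_add] at h1
  simp only [List.map_const', List.sum_replicate, nsmul_eq_mul] at h1
  linarith

end Blocks

/-! ### Greedy parsing. -/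

section Greedy

variable {A : Type*}

theorem exists_letter_blocks {cost : List A → ℝ} {L : ℝ} (hL : ∀ x, cost (initialWord x 1) ≤ L)
    (N : ℕ) (x : ℕ → A) : ∃ l : List (List A), (∀ w ∈ l, w ≠ []) ∧ l.flatten = initialWord x N ∧
      (l.map cost).sum ≤ L * N := by
  induction N generalizing x with
  | zero => exact ⟨[], by simp⟩
  | succ N ih =>
    obtain ⟨l, h1, h2, h3⟩ := ih (shift x)
    refine ⟨initialWord x 1 :: l, ?_, ?_, ?_⟩
    · simpa [initialWord_succ] using h1
    · simp [initialWord_succ, h2]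
    · have := hL x
      simp only [List.map_cons, List.sum_cons]
      push_cast
      linarith

/-- Greedy parsing: positions are either penalized by `f`, or the start of a block of length at
most `M` with cost at most `β` per letter. -/
theorem exists_greedy_blocks {cost : List A → ℝ} {L β : ℝ} {M : ℕ} {f : (ℕ → A) → ℝ}
    (hL0 : 0 ≤ L) (hβ : 0 ≤ β) (hf : ∀ x, 0 ≤ f x) (hL : ∀ x, cost (initialWord x 1) ≤ L)
    (N : ℕ) {x : ℕ → A} (h : ∀ j, 1 ≤ f (shift^[j] x) ∨
      ∃ n, 0 < n ∧ n ≤ M ∧ cost (initialWord (shift^[j] x) n) ≤ β * n) :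
    ∃ l : List (List A), (∀ w ∈ l, w ≠ []) ∧ l.flatten = initialWord x N ∧
      (l.map cost).sum ≤ β * N + L * (birkhoffSum shift f N x + M) := by
  have hB : ∀ n y, 0 ≤ birkhoffSum shift f n y := fun n y => Finset.sum_nonneg fun k _ => hf _
  induction N using Nat.strong_induction_on generalizing x with
  | _ N ih =>
  have hstep : ∀ n, 0 < n → n ≤ N →
      cost (initialWord x n) ≤ β * n + L * birkhoffSum shift f n x →
      ∃ l : List (List A), (∀ w ∈ l, w ≠ []) ∧ l.flatten = initialWord x N ∧
        (l.map cost).sum ≤ β * N + L * (birkhoffSum shift f N x + M) := by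
    intro n hn hnN hc
    obtain ⟨m, rfl⟩ := Nat.exists_eq_add_of_le hnN
    obtain ⟨l, h1, h2, h3⟩ := ih m (by omega) (x := shift^[n] x) fun j => by
      rw [← Function.iterate_add_apply]; exact h _
    refine ⟨initialWord x n :: l, ?_, ?_, ?_⟩
    · intro w hw
      rcases List.mem_cons.1 hw with rfl | hw
      · exact List.length_pos_iff.1 (by simpa using hn)
      · exact h1 w hw
    · rw [List.flatten_cons, h2, initialWord_add]
    · rw [List.map_cons, List.sum_cons, birkhoffSum_add]
      push_cast
      linarith
  rcases Nat.eq_zero_or_pos N with rfl | hN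
  · exact ⟨[], by simp, by simp, by simpa using by positivity⟩
  rcases h 0 with h0 | ⟨n, hn, hnM, hc⟩
  · refine hstep 1 one_pos hN ((hL x).trans ?_)
    rw [birkhoffSum_one]
    have := mul_le_mul_of_nonneg_left h0 hL0
    rw [Function.iterate_zero_apply] at this
    push_cast
    linarith
  · rw [Function.iterate_zero_apply] at hc
    rcases le_or_gt n N with hnN | hnN
    · exact hstep n hn hnN (by linarith [mul_nonneg hL0 (hB n x)])
    -- The good block overruns the end: fewer than `M` letters remain, and single letters cost at
    -- most `L * M`.
    · obtain ⟨l, h1, h2, h3⟩ := exists_letter_blocks hL N x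
      refine ⟨l, h1, h2, h3.trans ?_⟩
      have h4 : (N : ℝ) ≤ M := by exact_mod_cast hnN.le.trans hnM
      have h5 := mul_le_mul_of_nonneg_left h4 hL0
      have h6 := mul_nonneg hL0 (hB N x)
      have h7 := mul_nonneg hβ (Nat.cast_nonneg (α := ℝ) N)
      linarith

end Greedy

/-! ### The Shannon–McMillan–Breiman theorem, almost surely. -/

section ShannonMcMillanBreiman

variable {A : Type*} [Fintype A] [MeasurableSpace A] [MeasurableSingletonClass A]
  {P : Measure (ℕ → A)} [IsProbabilityMeasure P]

/-- The pointwise lower limit of `-(1/N) log P([x_1^N])`. -/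
noncomputable def lowerEntropyRate (P : Measure (ℕ → A)) (x : ℕ → A) : ℝ :=
  liminf (fun N => infoRate P N x) atTop

theorem measurable_infoRate (N : ℕ) : Measurable (infoRate P N) :=
  (measurable_comp_initialWord (negLogProb P) N).const_mul _

theorem measurable_lowerEntropyRate : Measurable (lowerEntropyRate P) :=
  Measurable.liminf measurable_infoRate

theorem infoRate_nonneg (N : ℕ) (x : ℕ → A) : 0 ≤ infoRate P N x :=
  mul_nonneg (by positivity) (negLogProb_nonneg _)

theorem isBoundedUnder_ge_infoRate (x : ℕ → A) :
    IsBoundedUnder (· ≥ ·) atTop fun N => infoRate P N x :=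
  isBoundedUnder_of ⟨0, fun N => infoRate_nonneg N x⟩

/-- The envelope makes the real-valued `liminf` meaningful almost everywhere, and integrable. -/
theorem exists_integrable_infoRate_le :
    ∃ B : (ℕ → A) → ℝ, Integrable B P ∧ ∀ᵐ x ∂P, ∀ N, infoRate P N x ≤ B x := by
  obtain ⟨θ, Z, h0, hZi, hZ, h⟩ := exists_integrable_negLogProb_le_linear (P := P)
  refine ⟨fun x => θ + Z x, (integrable_const θ).add hZi, ?_⟩
  filter_upwards [h] with x hx N
  rcases Nat.eq_zero_or_pos N with rfl | hN
  · simp only [infoRate, Nat.cast_zero, div_zero, zero_mul]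
    linarith [hZ x]
  · have h1 : (1 : ℝ) ≤ N := by exact_mod_cast hN
    have h2 := Real.log_le_sub_one_of_pos (zero_lt_one.trans_le (hZ x))
    rw [infoRate, one_div, inv_mul_le_iff₀ (by linarith)]
    nlinarith [hx N, hZ x]

theorem ae_isBoundedUnder_le_infoRate :
    ∀ᵐ x ∂P, IsBoundedUnder (· ≤ ·) atTop fun N => infoRate P N x := by
  obtain ⟨B, -, hB⟩ := exists_integrable_infoRate_le (P := P)
  exact hB.mono fun x hx => isBoundedUnder_of ⟨B x, hx⟩

theorem ae_lowerEntropyRate_nonneg : ∀ᵐ x ∂P, 0 ≤ lowerEntropyRate P x := by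
  filter_upwards [ae_isBoundedUnder_le_infoRate (P := P)] with x hx
  exact le_liminf_of_le hx.isCoboundedUnder_ge (Eventually.of_forall fun N => infoRate_nonneg N x)

theorem integrable_lowerEntropyRate : Integrable (lowerEntropyRate P) P := by
  obtain ⟨B, hBi, hB⟩ := exists_integrable_infoRate_le (P := P)
  refine hBi.mono' measurable_lowerEntropyRate.aestronglyMeasurable ?_
  filter_upwards [hB, ae_lowerEntropyRate_nonneg (P := P)] with x hx h0
  rw [Real.norm_eq_abs, abs_of_nonneg h0]
  exact liminf_le_of_frequently_le (Frequently.of_forall hx) (isBoundedUnder_ge_infoRate x)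

theorem negLogProb_eq_infoRate_mul {N : ℕ} (hN : 0 < N) (x : ℕ → A) :
    negLogProb P (initialWord x N) = infoRate P N x * N := by
  rw [infoRate]; field_simp

variable (hP : MeasurePreserving (shift : (ℕ → A) → (ℕ → A)) P P)
include hP

/-- Deleting the first letter does not increase the information, so the lower rate cannot increase
along orbits; integrability then forces invariance. -/
theorem ae_lowerEntropyRate_shift :
    ∀ᵐ x ∂P, lowerEntropyRate P (shift x) = lowerEntropyRate P x := by
  refine hP.ae_comp_eq_of_ae_comp_le integrable_lowerEntropyRate ?_
  filter_upwards [ae_isBoundedUnder_le_infoRate (P := P), ae_measure_cylinder_ne_zero (P := P)]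
    with x hx hpos
  refine le_of_forall_lt fun a ha => ?_
  obtain ⟨b, hab, hb⟩ := exists_between ha
  refine hab.trans_le ?_
  obtain ⟨c, hbc, hc⟩ := exists_between hb
  have h1 : ∀ᶠ N in atTop, c < infoRate P N (shift x) :=
    eventually_lt_of_lt_liminf hc (isBoundedUnder_ge_infoRate _)
  refine le_liminf_of_le hx.isCoboundedUnder_ge ?_
  -- This is `b * (N + 1) ≤ c * N`, which absorbs the change of length.
  have h2 : ∀ᶠ N : ℕ in atTop, b / (c - b) ≤ N :=
    tendsto_natCast_atTop_atTop.eventually_ge_atTop _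
  have h3 : ∀ᶠ N in atTop, b ≤ infoRate P (N + 1) x := by
    filter_upwards [h1, h2, eventually_gt_atTop 0] with N h4 h5 hN
    rw [div_le_iff₀ (by linarith)] at h5
    have h6 := condInfo_nonneg hP hpos N
    rw [condInfo, negLogProb_eq_infoRate_mul N.succ_pos, negLogProb_eq_infoRate_mul hN] at h6
    have h7 : (0 : ℝ) < N := by exact_mod_cast hN
    push_cast at h6
    have h8 : b * (N + 1) ≤ infoRate P (N + 1) x * (N + 1) := by nlinarith
    exact le_of_mul_le_mul_right h8 (by linarith)
  filter_upwards [(tendsto_sub_atTop_nat 1).eventually h3, eventually_gt_atTop 0] with N hN hN0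
  rwa [Nat.sub_add_cancel hN0] at hN

omit hP

/-- The sequences such that no `n ∈ [m, M]` satisfies `-log P([x_1^n]) ≤ (lowerEntropyRate P x + ε) n`. -/
def lateSet (P : Measure (ℕ → A)) (ε : ℝ) (m M : ℕ) : Set (ℕ → A) :=
  {x | ∀ n, m ≤ n → n ≤ M → (lowerEntropyRate P x + ε) * n < negLogProb P (initialWord x n)}

theorem measurableSet_lateSet (ε : ℝ) (m M : ℕ) : MeasurableSet (lateSet P ε m M) := by
  have : lateSet P ε m M = ⋂ n, ⋂ (_ : m ≤ n), ⋂ (_ : n ≤ M),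
      {x | (lowerEntropyRate P x + ε) * n < negLogProb P (initialWord x n)} := by
    ext; simp [lateSet]
  rw [this]
  exact .iInter fun n => .iInter fun _ => .iInter fun _ => measurableSet_lt
    ((measurable_lowerEntropyRate.add_const ε).mul_const _) (measurable_comp_initialWord _ n)

theorem integrable_indicator_lateSet (ε : ℝ) (m M : ℕ) :
    Integrable ((lateSet P ε m M).indicator fun _ => (1 : ℝ)) P :=
  (integrable_const 1).indicator (measurableSet_lateSet ε m M)

theorem tendsto_integral_indicator_lateSet {ε : ℝ} (hε : 0 < ε) (m : ℕ) :
    Tendsto (fun M => ∫ x, (lateSet P ε m M).indicator (fun _ => (1 : ℝ)) x ∂P) atTop (𝓝 0) := by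
  rw [← integral_zero (ℕ → A) ℝ (μ := P)]
  refine tendsto_integral_of_dominated_convergence (fun _ => 1)
    (fun M => (integrable_indicator_lateSet ε m M).aestronglyMeasurable) (integrable_const 1)
    (fun M => ae_of_all _ fun x => ?_) ?_
  · by_cases h : x ∈ lateSet P ε m M <;> simp [h]
  · filter_upwards [ae_isBoundedUnder_le_infoRate (P := P)] with x hx
    have h1 : ∃ᶠ N in atTop, infoRate P N x < lowerEntropyRate P x + ε :=
      frequently_lt_of_liminf_lt hx.isCoboundedUnder_ge (lt_add_of_pos_right _ hε)
    obtain ⟨n, hn, hlt⟩ := frequently_atTop.1 h1 (m + 1)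
    refine tendsto_const_nhds.congr' ?_
    filter_upwards [eventually_ge_atTop n] with M hM
    refine (Set.indicator_of_notMem (fun hmem => ?_) _).symm
    have h2 := hmem n (by omega) hM
    rw [negLogProb_eq_infoRate_mul (by omega)] at h2
    exact absurd h2 (not_lt.2 (by gcongr))

include hP

/-- The lower rate is invariant, so most positions of the orbit start a block of length in `[m + 1,
M]` whose rate exceeds it by at most `ε`. The greedy parsing by such blocks is cheap, and
`ae_negLogProb_le_sum_blocks` passes this on to `x_1^N`. The other three `ε` pay for the charge `κ`
per block, for `θ = ε`, and for late positions with the boundary terms. -/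
theorem ae_eventually_infoRate_le {ε : ℝ} (hε : 0 < ε) :
    ∀ᵐ x ∂P, ∀ᶠ N in atTop, infoRate P N x ≤ lowerEntropyRate P x + 4 * ε := by
  obtain ⟨κ, hκ0, hκ⟩ : ∃ κ : ℝ, 0 ≤ κ ∧ Real.exp (-κ) < ε :=
    ((eventually_ge_atTop 0).and
      (Real.tendsto_exp_neg_atTop_nhds_zero.eventually_lt_const hε)).exists
  obtain ⟨L, hL0, hL⟩ := exists_negLogProb_le (P := P) 1
  -- Blocks longer than `m` absorb the charge: `κ ≤ ε * n`.
  obtain ⟨m, hm⟩ := exists_nat_ge (κ / ε)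
  rw [div_le_iff₀ hε] at hm
  set f : ℕ → (ℕ → A) → ℝ := fun M => (lateSet P ε (m + 1) M).indicator fun _ => (1 : ℝ) with hf
  have hf0 : ∀ M x, 0 ≤ f M x := fun M x => Set.indicator_nonneg (fun _ _ => zero_le_one) x
  -- Without ergodicity the asymptotic frequency of late positions is bounded by a conditional
  -- expectation, so `M` depends on `x`.
  have hcond : ∀ᵐ x ∂P, ∀ η > 0, ∃ M, (P[f M|MeasurableSpace.invariants shift]) x < η := by
    refine ae_exists_lt_of_exists_integral_lt (fun M => integrable_condExp)
      (fun M => condExp_nonneg (ae_of_all _ (hf0 M))) fun η hη => ?_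
    simp_rw [integral_condExp (MeasurableSpace.invariants_le _)]
    exact ((tendsto_integral_indicator_lateSet hε (m + 1)).eventually_lt_const hη).exists
  have hbirk := ae_all_iff.2 fun M =>
    hP.ae_eventually_birkhoffSum_le (integrable_indicator_lateSet (P := P) ε (m + 1) M)
  filter_upwards [hcond, hbirk, ae_forall_iterate hP (ae_lowerEntropyRate_shift hP),
    ae_lowerEntropyRate_nonneg (P := P), ae_negLogProb_le_sum_blocks hP hκ]
    with x h1 h2 h3 h0 h4
  have hinv : ∀ j, lowerEntropyRate P (shift^[j] x) = lowerEntropyRate P x := by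
    intro j
    induction j with
    | zero => rfl
    | succ j ih => rw [Function.iterate_succ_apply', h3 j, ih]
  obtain ⟨C, hC⟩ := h4
  set η := ε / (4 * (L + κ + 1)) with hη
  have hη0 : 0 < η := by positivity
  have hηL : (L + κ) * (2 * η) ≤ ε / 2 := by
    rw [hη, mul_div_assoc', mul_div_assoc', div_le_iff₀ (by positivity)]
    nlinarith
  obtain ⟨M, hM⟩ := h1 η hη0
  have hlarge : ∀ᶠ N : ℕ in atTop, ((L + κ) * M + C) / (ε / 2) ≤ N :=
    tendsto_natCast_atTop_atTop.eventually_ge_atTop _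
  filter_upwards [h2 M η hη0, hlarge, eventually_gt_atTop 0] with N h5 h6 hN
  have hN' : (0 : ℝ) < N := by exact_mod_cast hN
  obtain ⟨l, hl, hl', hsum⟩ := exists_greedy_blocks (cost := fun w => negLogProb P w + κ)
    (L := L + κ) (β := lowerEntropyRate P x + ε + ε) (M := M) (f := f M) (by positivity)
    (by positivity) (hf0 M) (fun y => by linarith [hL y 1 le_rfl]) N (x := x) (by
      intro j
      by_cases hj : shift^[j] x ∈ lateSet P ε (m + 1) M
      · left; simp [hf, hj]
      · right
        simp only [lateSet, Set.mem_ofPred_eq, not_forall, not_lt, hinv] at hj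
        obtain ⟨n, hmn, hnM, hn⟩ := hj
        refine ⟨n, by omega, hnM, ?_⟩
        have : (m : ℝ) ≤ n := by exact_mod_cast (Nat.le_succ m).trans hmn
        nlinarith)
  have h7 := hC N l hl hl'
  rw [div_le_iff₀ (by positivity)] at h6
  rw [negLogProb_eq_infoRate_mul hN] at h7
  have h8 : birkhoffSum shift (f M) N x ≤ 2 * η * N :=
    h5.trans (by gcongr; linarith)
  have h9 : (L + κ) * birkhoffSum shift (f M) N x ≤ ε / 2 * N :=
    calc (L + κ) * birkhoffSum shift (f M) N x ≤ (L + κ) * (2 * η * N) := by gcongr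
      _ = (L + κ) * (2 * η) * N := by ring
      _ ≤ _ := by gcongr
  refine le_of_mul_le_mul_right ?_ hN'
  linarith

theorem ae_tendsto_infoRate :
    ∀ᵐ x ∂P, Tendsto (fun N => infoRate P N x) atTop (𝓝 (lowerEntropyRate P x)) := by
  have key : ∀ᵐ x ∂P, ∀ k : ℕ, _ := ae_all_iff.2 fun k : ℕ =>
    ae_eventually_infoRate_le hP (ε := 1 / ((k : ℝ) + 1)) (by positivity)
  filter_upwards [key] with x hx
  refine tendsto_order.2 ⟨fun a ha => eventually_lt_of_lt_liminf ha (isBoundedUnder_ge_infoRate x),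
    fun a ha => ?_⟩
  obtain ⟨k, hk⟩ := exists_nat_one_div_lt (show 0 < (a - lowerEntropyRate P x) / 4 by linarith)
  filter_upwards [hx k] with N hN
  linarith

theorem ae_entropyRateFunction_eq :
    entropyRateFunction P =ᵐ[P] lowerEntropyRate P :=
  (ae_tendsto_infoRate hP).mono fun _ hx => hx.limsup_eq

theorem ae_tendsto_infoRate_entropyRateFunction :
    ∀ᵐ x ∂P, Tendsto (fun N => infoRate P N x) atTop (𝓝 (entropyRateFunction P x)) := by
  filter_upwards [ae_tendsto_infoRate hP, ae_entropyRateFunction_eq hP] with x hx h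
  rwa [h]

theorem integrable_entropyRateFunction : Integrable (entropyRateFunction P) P :=
  integrable_lowerEntropyRate.congr (ae_entropyRateFunction_eq hP).symm

theorem ae_entropyRateFunction_shift :
    ∀ᵐ x ∂P, entropyRateFunction P (shift x) = entropyRateFunction P x := by
  filter_upwards [ae_entropyRateFunction_eq hP, ae_lowerEntropyRate_shift hP,
    hP.quasiMeasurePreserving.ae (ae_entropyRateFunction_eq hP)] with x h1 h2 h3
  rw [h1, h3, h2]

end ShannonMcMillanBreiman

/-! ### Uniform integrability and convergence in `L¹`. -/

section MeanConvergence

variable {A : Type*} [Fintype A] [MeasurableSpace A] [MeasurableSingletonClass A]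

theorem Parsing.measurable_average (W : Parsing A) (P : Measure (ℕ → A)) (N : ℕ) :
    Measurable (W.average P N) := by
  let _ : MeasurableSpace (List (List A)) := ⊤
  have hb : Measurable (W.blocks N) := measurable_to_countable' fun l =>
    W.measurableSet_blocks_eq N l
  exact (measurable_from_top (f := fun l : List (List A) =>
    (1 / (N : ℝ)) * (l.map (negLogProb P)).sum)).comp hb

variable {P : Measure (ℕ → A)} [IsProbabilityMeasure P]

theorem Parsing.average_nonneg (W : Parsing A) (N : ℕ) (x : ℕ → A) : 0 ≤ W.average P N x :=
  mul_nonneg (by positivity) (List.sum_nonneg fun r hr => by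
    obtain ⟨w, -, rfl⟩ := List.mem_map.1 hr
    exact negLogProb_nonneg w)

variable (hP : MeasurePreserving (shift : (ℕ → A) → (ℕ → A)) P P)
include hP

/-- A truncation bound for the averages over all parsings. -/
theorem exists_average_le_add :
    ∃ (θ c : ℝ), 0 ≤ θ ∧ 0 ≤ c ∧ ∀ K, 0 ≤ K → ∀ N, ∃ G : (ℕ → A) → ℝ, Integrable G P ∧
      0 ≤ G ∧ ∫ x, G x ∂P ≤ Real.exp (-K) * c ∧
      ∀ W : Parsing A, ∀ᵐ x ∂P, W.average P N x ≤ θ + K + G x := by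
  obtain ⟨θ, Z, h0, hZi, hZ, h⟩ := exists_ae_sum_blocks_le_linear hP
  have hZ0 : 0 ≤ Z := fun x => zero_le_one.trans (hZ x)
  refine ⟨θ, ∫ x, Z x ∂P, h0, integral_nonneg hZ0, fun K hK N =>
    ⟨fun x => (1 / (N : ℝ)) * (Real.exp (-K) * birkhoffSum shift Z N x),
      ((hP.integrable_birkhoffSum hZi N).const_mul _).const_mul _, fun x => ?_, ?_, fun W => ?_⟩⟩
  · exact mul_nonneg (by positivity) (mul_nonneg (by positivity)
      (Finset.sum_nonneg fun k _ => hZ0 _))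
  · rw [integral_const_mul, integral_const_mul, hP.integral_birkhoffSum hZi]
    rcases Nat.eq_zero_or_pos N with rfl | hN
    · simpa using mul_nonneg (Real.exp_pos _).le (integral_nonneg hZ0)
    · apply le_of_eq; field_simp
  · filter_upwards [h] with x hx
    rcases Nat.eq_zero_or_pos N with rfl | hN
    · simp only [Parsing.average, Nat.cast_zero, div_zero, zero_mul, add_zero]
      positivity
    · have h1 := hx K hK N _ (W.blocks_ne_nil N x) (W.flatten_blocks N x)
      have h2 : (0 : ℝ) < N := by exact_mod_cast hN
      rw [Parsing.average, one_div, inv_mul_le_iff₀ h2]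
      refine h1.trans_eq ?_
      field_simp

theorem Parsing.integrable_average (W : Parsing A) (N : ℕ) : Integrable (W.average P N) P := by
  obtain ⟨θ, c, -, -, h⟩ := exists_average_le_add hP
  obtain ⟨G, hG, -, -, hW⟩ := h 0 le_rfl N
  refine ((integrable_const (θ + 0)).add hG).mono'
    (W.measurable_average P N).aestronglyMeasurable ?_
  filter_upwards [hW W] with x hx
  rwa [Real.norm_eq_abs, abs_of_nonneg (W.average_nonneg N x)]

/-- The part above `θ + K` has integral at most `exp (-K) * c` for every `N`; `K` is fixed first,
then the size of the set. -/
theorem Parsing.unifIntegrable_average (W : Parsing A) : UnifIntegrable (W.average P) 1 P := by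
  obtain ⟨θ, c, hθ, hc, h⟩ := exists_average_le_add hP
  intro ε hε
  obtain ⟨K, hK0, hK⟩ : ∃ K : ℝ, 0 ≤ K ∧ Real.exp (-K) * c < ε / 2 := by
    have : Tendsto (fun K : ℝ => Real.exp (-K) * c) atTop (𝓝 (0 * c)) :=
      Real.tendsto_exp_neg_atTop_nhds_zero.mul_const _
    rw [zero_mul] at this
    exact ((eventually_ge_atTop 0).and (this.eventually_lt_const (half_pos hε))).exists
  refine ⟨ε / 2 / (θ + K + 1), by positivity, fun N s hs hμ => ?_⟩
  obtain ⟨G, hG, hG0, hGc, hW⟩ := h K hK0 N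
  rw [eLpNorm_one_eq_lintegral_enorm]
  simp_rw [enorm_indicator_eq_indicator_enorm]
  rw [lintegral_indicator hs]
  calc ∫⁻ x in s, ‖W.average P N x‖ₑ ∂P
      ≤ ∫⁻ x in s, ENNReal.ofReal (θ + K) + ENNReal.ofReal (G x) ∂P := by
        refine lintegral_mono_ae (ae_restrict_of_ae ?_)
        filter_upwards [hW W] with x hx
        rw [Real.enorm_of_nonneg (W.average_nonneg N x),
          ← ENNReal.ofReal_add (by positivity) (hG0 x)]
        exact ENNReal.ofReal_le_ofReal hx
    _ = ENNReal.ofReal (θ + K) * P s + ∫⁻ x in s, ENNReal.ofReal (G x) ∂P := by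
        rw [lintegral_add_left measurable_const, setLIntegral_const]
    _ ≤ ENNReal.ofReal (θ + K) * ENNReal.ofReal (ε / 2 / (θ + K + 1))
          + ENNReal.ofReal (Real.exp (-K) * c) := by
        refine add_le_add (by gcongr) ((setLIntegral_le_lintegral _ _).trans ?_)
        rw [← ofReal_integral_eq_lintegral_ofReal hG (ae_of_all _ hG0)]
        exact ENNReal.ofReal_le_ofReal hGc
    _ ≤ ENNReal.ofReal ε := by
        rw [← ENNReal.ofReal_mul (by positivity), ← ENNReal.ofReal_add (by positivity)
          (by positivity)]
        refine ENNReal.ofReal_le_ofReal ?_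
        have : (θ + K) * (ε / 2 / (θ + K + 1)) ≤ ε / 2 := by
          rw [mul_div_assoc', div_le_iff₀ (by positivity)]
          nlinarith
        linarith

theorem Parsing.tendstoInL1_average (W : Parsing A) {h : (ℕ → A) → ℝ} (hh : Integrable h P)
    (hlim : ∀ᵐ x ∂P, Tendsto (fun N => W.average P N x) atTop (𝓝 (h x))) :
    TendstoInL1 P (W.average P) h :=
  ⟨W.integrable_average hP, hh, tendsto_Lp_finite_of_tendsto_ae le_rfl ENNReal.one_ne_top
    (fun N => (W.measurable_average P N).aestronglyMeasurable) (memLp_one_iff_integrable.2 hh)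
    (W.unifIntegrable_average hP) hlim⟩

end MeanConvergence

/-! ### The one-block parsing, which transfers the `L¹` criterion to `infoRate`. -/

section TrivialParsing

variable {A : Type*} [Fintype A] [MeasurableSpace A] [MeasurableSingletonClass A]

/-- The parsing of `x_1^N` into a single block. -/
def trivialParsing (A : Type*) [Fintype A] [MeasurableSpace A] [MeasurableSingletonClass A] :
    Parsing A where
  blocks N x := if N = 0 then [] else [initialWord x N]
  measurableSet_blocks_eq N l := by
    let _ : MeasurableSpace (List (List A)) := ⊤
    exact measurable_comp_initialWord (fun w => if N = 0 then [] else [w]) N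
      (MeasurableSpace.measurableSet_top (s := {l}))
  blocks_ne_nil N x w hw := by
    split_ifs at hw with h
    · simp at hw
    · rw [List.mem_singleton] at hw
      exact List.length_pos_iff.1 (by simp [hw]; omega)
  flatten_blocks N x := by
    split_ifs with h
    · simp [h]
    · simp

theorem average_trivialParsing (P : Measure (ℕ → A)) :
    (trivialParsing A).average P = infoRate P := by
  ext N x
  by_cases h : N = 0 <;> simp [Parsing.average, trivialParsing, infoRate, h]

end TrivialParsing

/-! ### Identification of the entropy rate and convergence along parsings. -/

section Main

variable {A : Type*} [Fintype A] [MeasurableSpace A] [MeasurableSingletonClass A]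
  {P : Measure (ℕ → A)} [IsProbabilityMeasure P]
  (hP : MeasurePreserving (shift : (ℕ → A) → (ℕ → A)) P P)
include hP

theorem isEntropyRateFunction_entropyRateFunction :
    IsEntropyRateFunction P (entropyRateFunction P) where
  integrable := integrable_entropyRateFunction hP
  shift_invariant := ae_entropyRateFunction_shift hP
  tendsto_ae := ae_tendsto_infoRate_entropyRateFunction hP
  tendsto_L1 := by
    rw [← average_trivialParsing]
    exact (trivialParsing A).tendstoInL1_average hP (integrable_entropyRateFunction hP)
      (by rw [average_trivialParsing]; exact ae_tendsto_infoRate_entropyRateFunction hP)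

theorem tendsto_blockEntropy_div :
    Tendsto (fun n : ℕ => (1 / (n : ℝ)) * blockEntropy P n) atTop
      (𝓝 (∫ x, entropyRateFunction P x ∂P)) := by
  obtain ⟨h1, h2, h3⟩ := (isEntropyRateFunction_entropyRateFunction hP).tendsto_L1
  refine (tendsto_integral_of_L1' _ h2.aestronglyMeasurable (Eventually.of_forall h1) h3).congr fun n => ?_
  rw [← integral_negLogProb]
  exact integral_const_mul _ _

/-- The integrals are the increments of the block entropy; if all were at least `e + ε`, telescoping
would contradict the limit `e` of `blockEntropy P n / n`. -/
theorem exists_integral_condInfo_lt {ε : ℝ} (hε : 0 < ε) :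
    ∃ k, ∫ x, condInfo P k x ∂P < ∫ x, entropyRateFunction P x ∂P + ε := by
  by_contra! hcon
  set e := ∫ x, entropyRateFunction P x ∂P
  have h1 : ∀ n : ℕ, n * (e + ε) ≤ blockEntropy P n := by
    intro n
    induction n with
    | zero => rw [← integral_negLogProb]; simp [negLogProb_nil]
    | succ n ih =>
      have := hcon n
      rw [integral_condInfo hP] at this
      push_cast
      linarith
  have h2 : e + ε ≤ e := ge_of_tendsto (tendsto_blockEntropy_div hP) (by
    filter_upwards [eventually_gt_atTop 0] with n hn
    have h3 : (0 : ℝ) < n := by exact_mod_cast hn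
    rw [one_div, le_inv_mul_iff₀ h3]
    exact h1 n)
  linarith

/-- This is the upper bound for block sums, applied to the one-block parsing. -/
theorem ae_entropyRateFunction_le_condExp (k : ℕ) :
    ∀ᵐ x ∂P, entropyRateFunction P x
      ≤ (P[condInfo P k|MeasurableSpace.invariants shift]) x := by
  filter_upwards [ae_tendsto_infoRate_entropyRateFunction hP, ae_sum_blocks_le_condInfo hP k]
    with x h1 h2
  refine le_of_forall_pos_le_add fun η hη => ?_
  obtain ⟨D, hD⟩ := h2 η hη
  have h3 : Tendsto (fun N : ℕ => D / N + ((P[condInfo P k|MeasurableSpace.invariants shift]) x + η))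
      atTop (𝓝 (0 + ((P[condInfo P k|MeasurableSpace.invariants shift]) x + η))) :=
    (tendsto_const_div_atTop_nhds_zero_nat D).add_const _
  rw [zero_add] at h3
  refine le_of_tendsto_of_tendsto h1 h3 ?_
  filter_upwards [hD, eventually_gt_atTop 0] with N hN hN0
  have h4 : (0 : ℝ) < N := by exact_mod_cast hN0
  have h5 := hN [initialWord x N] (by
    intro w hw
    rw [List.mem_singleton] at hw
    exact List.length_pos_iff.1 (by simpa [hw] using hN0)) (by simp)
  simp only [List.map_cons, List.map_nil, List.sum_cons, List.sum_nil, List.length_singleton,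
    Nat.cast_one, mul_one, add_zero] at h5
  rw [infoRate, one_div, inv_mul_le_iff₀ h4]
  refine h5.trans_eq ?_
  field_simp

/-- The differences are nonnegative with integrals arbitrarily close to `0`, so pointwise closeness
needs neither ergodicity nor monotonicity in `k`. -/
theorem ae_exists_condExp_lt :
    ∀ᵐ x ∂P, ∀ η > 0, ∃ k,
      (P[condInfo P k|MeasurableSpace.invariants shift]) x < entropyRateFunction P x + η := by
  have hi := integrable_entropyRateFunction hP
  have := ae_exists_lt_of_exists_integral_lt (μ := P)
    (f := fun k x => (P[condInfo P k|MeasurableSpace.invariants shift]) x - entropyRateFunction P x)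
    (fun k => integrable_condExp.sub hi)
    (fun k => (ae_entropyRateFunction_le_condExp hP k).mono fun x hx => sub_nonneg.2 hx)
    (fun ε hε => by
      obtain ⟨k, hk⟩ := exists_integral_condInfo_lt hP hε
      refine ⟨k, ?_⟩
      rw [integral_sub integrable_condExp hi, integral_condExp (MeasurableSpace.invariants_le _)]
      linarith)
  filter_upwards [this] with x hx η hη
  obtain ⟨k, hk⟩ := hx η hη
  exact ⟨k, by linarith⟩

/-- Both bounds have an error `D * c_N(x)` with `D` independent of `N`, negligible against `N`. The
lower one starts from the limit of `infoRate`, the upper one from an order `k` adapted to `x`. -/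
theorem Parsing.ae_tendsto_average (W : Parsing A)
    (hW : ∀ᵐ x ∂P, Tendsto (fun N : ℕ => (W.count N x : ℝ) / (N : ℝ)) atTop (𝓝 0)) :
    ∀ᵐ x ∂P, Tendsto (fun N : ℕ => W.average P N x) atTop (𝓝 (entropyRateFunction P x)) := by
  filter_upwards [hW, ae_exists_condExp_lt hP, ae_all_iff.2 (ae_sum_blocks_le_condInfo hP),
    ae_negLogProb_le_sum_blocks_add hP, ae_tendsto_infoRate_entropyRateFunction hP]
    with x hc hinf hup hlow hsmb
  set e := entropyRateFunction P x
  have hD0 : ∀ D : ℝ, Tendsto (fun N : ℕ => D * ((W.count N x : ℝ) / N)) atTop (𝓝 0) := fun D => by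
    simpa using hc.const_mul D
  refine tendsto_order.2 ⟨fun a ha => ?_, fun a ha => ?_⟩
  · obtain ⟨D, hD⟩ := hlow ((e - a) / 3) (by linarith)
    filter_upwards [hD, (hD0 D).eventually_lt_const (show 0 < (e - a) / 3 by linarith),
      hsmb.eventually_const_lt (show e - (e - a) / 3 < e by linarith), eventually_gt_atTop 0]
      with N h1 h2 h3 hN
    have h4 : (0 : ℝ) < N := by exact_mod_cast hN
    have h5 := h1 _ (W.blocks_ne_nil N x) (W.flatten_blocks N x)
    rw [mul_div_assoc', div_lt_iff₀ h4, Parsing.count] at h2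
    rw [negLogProb_eq_infoRate_mul hN] at h5
    have h6 := mul_lt_mul_of_pos_right h3 h4
    rw [Parsing.average, one_div, lt_inv_mul_iff₀ h4]
    linarith
  · obtain ⟨k, hk⟩ := hinf ((a - e) / 3) (by linarith)
    obtain ⟨D, hD⟩ := hup k ((a - e) / 3) (by linarith)
    filter_upwards [hD, (hD0 D).eventually_lt_const (show 0 < (a - e) / 3 by linarith),
      eventually_gt_atTop 0] with N h1 h2 hN
    have h4 : (0 : ℝ) < N := by exact_mod_cast hN
    have h5 := h1 _ (W.blocks_ne_nil N x) (W.flatten_blocks N x)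
    rw [mul_div_assoc', div_lt_iff₀ h4, Parsing.count] at h2
    have h6 := mul_lt_mul_of_pos_right hk h4
    rw [Parsing.average, one_div, inv_mul_lt_iff₀ h4]
    linarith

end Main

end ShiftSpace

theorem theorem1 {A : Type*} [Fintype A] [MeasurableSpace A] [MeasurableSingletonClass A]
    (P : Measure (ℕ → A)) [IsProbabilityMeasure P]
    (hP : MeasurePreserving (ShiftSpace.shift : (ℕ → A) → (ℕ → A)) P P) :
    -- the entropy rate function is well defined, with the properties that characterize it
    ShiftSpace.IsEntropyRateFunction P (ShiftSpace.entropyRateFunction P) ∧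
    -- convergence along every sublinear parsing, almost surely and in L¹
    (∀ W : ShiftSpace.Parsing A,
      (∀ᵐ x ∂P, Tendsto (fun N : ℕ => (W.count N x : ℝ) / (N : ℝ)) atTop (𝓝 0)) →
      (∀ᵐ x ∂P, Tendsto (fun N : ℕ => W.average P N x) atTop
        (𝓝 (ShiftSpace.entropyRateFunction P x))) ∧
      ShiftSpace.TendstoInL1 P (W.average P) (ShiftSpace.entropyRateFunction P)) ∧
    -- the limit that defines the entropy rate exists, and it is the mean of the rate function
    Tendsto (fun n : ℕ => (1 / (n : ℝ)) * ShiftSpace.blockEntropy P n) atTop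
      (𝓝 (ShiftSpace.entropyRate P)) ∧
    ∫ x, ShiftSpace.entropyRateFunction P x ∂P = ShiftSpace.entropyRate P := by
  have hrate : ShiftSpace.entropyRate P = ∫ x, ShiftSpace.entropyRateFunction P x ∂P :=
    (ShiftSpace.tendsto_blockEntropy_div hP).limUnder_eq
  refine ⟨ShiftSpace.isEntropyRateFunction_entropyRateFunction hP, fun W hW => ?_, ?_, hrate.symm⟩
  · have h := W.ae_tendsto_average hP hW
    exact ⟨h, W.tendstoInL1_average hP (ShiftSpace.integrable_entropyRateFunction hP) h⟩
  · rw [hrate]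
    exact ShiftSpace.tendsto_blockEntropy_div hP
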